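/- Let $n\ge 2$, let $a=(a_1,\dots,a_n)$ with real-valued $a_j\in L^\infty_{loc}(\mathbb R^n)$, and let $V\in L^1_{loc}(\mathbb R^n)$ be real-valued with $V\ge 0$. Put $\nabla_a u=\nabla u+iau$, and let $H_{a,V}$ be the operator in $L^2(\mathbb R^n)$ defined by the closure of the quadratic form $$h_{a,V}(u,u)=\int_{\mathbb R^n}\left(|\nabla_a u|^2+V|u|^2\right)dx,\qquad u\in C_c^\infty(\mathbb R^n).$$ For $d>0$ let $Q_d$ denote a closed cube with edge length $d$ and edges parallel to the coordinate axes, let $\overset{\circ}{Q}_d$ be its interior, and let $Q_d\to\infty$ mean that the center of $Q_d$ goes to infinity with $d$ fixed. The local energy of the magnetic field in $Q_d$ is $$\mu_0(Q_d)=\inf\left\{\frac{\int_{Q_d}|\nabla_a u|^2dx}{\int_{Q_d}|u|^2dx}\;:\; u\in \left(C^\infty(\overset{\circ}{Q}_d)\setminus\{0\}\right)\cap L^2(\overset{\circ}{Q}_d)\right\}.$$ For a compact set $F$ in an open set $\Omega\subset\mathbb R^n$ let $$\mathrm{cap}_\Omega(F)=\inf\left\{\int_{\mathbb R^n}|\nabla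 u|^2dx\;:\; u \text{ Lipschitz with compact support in } \Omega,\ u|_F=1\right\},$$ and for a compact set $F\subset Q_d$ let $\mathrm{cap}(F)=\mathrm{cap}_{\mathbb R^n}(F)$ if $n\ge 3$, and $\mathrm{cap}(F)=\mathrm{cap}_{\overset{\circ}{Q}_{2d}}(F)$ if $n=2$, where $Q_{2d}$ has the same center as $Q_d$. For $c>0$ let $$M_c(Q_d;V)=\inf\left\{\int_{Q_d\setminus F}V\,dx\;:\; F\subset Q_d \text{ compact},\ \mathrm{cap}(F)\le c\,\mathrm{cap}(Q_d)\right\}.$$ Suppose that there are $c>0$ and $d_1>0$ such that for every fixed $d\in(0,d_1)$ $$\mu_0(Q_d)+d^{-n}M_c(Q_d;V)\to+\infty\quad\text{as}\quad Q_d\to\infty.$$ Then the spectrum of $H_{a,V}$ is discrete, that is, it consists of isolated eigenvalues of finite multiplicities. -/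

import Mathlib

open MeasureTheory Filter Topology Set
open scoped ENNReal ContDiff ComplexConjugate

noncomputable section

namespace MagneticSchrodinger

/-- Euclidean space `ℝⁿ`. -/
abbrev Space (n : ℕ) : Type := EuclideanSpace ℝ (Fin n)

/-- The complex Hilbert space `L²(ℝⁿ)`. -/
abbrev L2 (n : ℕ) : Type := Lp ℂ 2 (volume : Measure (Space n))

/-- `f ∈ L^p_loc(ℝⁿ)`. -/
def LocMemLp {n : ℕ} (p : ℝ≥0∞) (f : Space n → ℝ) : Prop :=
  ∀ K : Set (Space n), IsCompact K → MemLp f p (volume.restrict K)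

/-- `a ∈ L^p_loc(ℝⁿ)` for a vector potential, that is, `a_j ∈ L^p_loc(ℝⁿ)` for all `j`. -/
def VecLocMemLp {n : ℕ} (p : ℝ≥0∞) (a : Space n → Space n) : Prop :=
  ∀ j : Fin n, LocMemLp p (fun x => a x j)

theorem LocMemLp.of_top {n : ℕ} {f : Space n → ℝ} (hf : LocMemLp ⊤ f) (p : ℝ≥0∞) :
    LocMemLp p f := by
  intro K hK
  have : IsFiniteMeasure ((volume : Measure (Space n)).restrict K) :=
    ⟨by simpa using hK.measure_lt_top⟩
  exact (hf K hK).mono_exponent le_top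

theorem VecLocMemLp.of_top {n : ℕ} {a : Space n → Space n} (ha : VecLocMemLp ⊤ a) (p : ℝ≥0∞) :
    VecLocMemLp p a := fun j => (ha j).of_top p

/-- The space `C_c^∞(ℝⁿ)` of complex-valued functions. -/
def testFunctions (n : ℕ) : Submodule ℂ (Space n → ℂ) where
  carrier := {φ | ContDiff ℝ ∞ φ ∧ HasCompactSupport φ}
  add_mem' := fun h h' => ⟨h.1.add h'.1, h.2.add h'.2⟩
  zero_mem' := ⟨contDiff_const, HasCompactSupport.zero⟩
  smul_mem' := fun c _ h => ⟨contDiff_const.smul h.1, h.2.smul_left (f := fun _ => c)⟩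

/-- The partial derivative `∂u/∂x^j`. -/
def partialDeriv {n : ℕ} (u : Space n → ℂ) (j : Fin n) (x : Space n) : ℂ :=
  fderiv ℝ u x (EuclideanSpace.single j (1 : ℝ))

/-- The `j`-th component `∂u/∂x^j + i a_j u` of the magnetic gradient `∇_a u`. -/
def magneticPartial {n : ℕ} (a : Space n → Space n) (u : Space n → ℂ) (j : Fin n)
    (x : Space n) : ℂ :=
  partialDeriv u j x + Complex.I * (a x j : ℂ) * u x

/-- The sesquilinear form `h_{a,V}(u,v) = ∫ (∇_a u · conj (∇_a v) + V u conj v) dx`, used for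
`u, v ∈ C_c^∞(ℝⁿ)`. -/
def magneticForm {n : ℕ} (a : Space n → Space n) (V : Space n → ℝ) (u v : Space n → ℂ) : ℂ :=
  ∫ x, ((∑ j, magneticPartial a u j x * conj (magneticPartial a v j x))
    + (V x : ℂ) * (u x * conj (v x)))

/-- `u` belongs to the domain of the operator defined by the closure of the form `h_{a,V}` on
`C_c^∞(ℝⁿ)`, and the operator sends `u` to `f`: there are `φ_k ∈ C_c^∞(ℝⁿ)` which converge to `u`
in `L²` and are Cauchy for the form (so `u` is in the domain of the closed form `h`, and
`h(u,ψ) = lim h(φ_k,ψ)`), and `h(u,ψ) = (f,ψ)` for all `ψ` in the form core `C_c^∞(ℝⁿ)`. -/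
def IsOperatorPair {n : ℕ} (a : Space n → Space n) (V : Space n → ℝ) (u f : L2 n) : Prop :=
  ∃ φ : ℕ → testFunctions n,
    Tendsto (fun k => eLpNorm (fun x => (φ k : Space n → ℂ) x - u x) 2 volume) atTop (𝓝 0) ∧
    Tendsto (fun q : ℕ × ℕ => magneticForm a V (φ q.1 - φ q.2 : testFunctions n)
      (φ q.1 - φ q.2 : testFunctions n)) atTop (𝓝 0) ∧
    ∀ ψ : testFunctions n,
      Tendsto (fun k => magneticForm a V (φ k) ψ) atTop
        (𝓝 (∫ x, f x * conj ((ψ : Space n → ℂ) x)))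

/-! ### The operator of the closed form is well defined -/

section WellDefined

variable {n : ℕ} {a : Space n → Space n} {V : Space n → ℝ}

theorem LocMemLp.memLp_mul {f : Space n → ℝ} (hf : LocMemLp 2 f) (φ : testFunctions n) :
    MemLp (fun x => (f x : ℂ) * (φ : Space n → ℂ) x) 2 volume := by
  obtain ⟨φ, hφ, hc⟩ := φ
  have h1 : MemLp (fun x => (f x : ℂ)) 2 (volume.restrict (tsupport φ)) :=
    (hf _ hc).ofReal
  have h2 : MemLp (fun x => (f x : ℂ) * φ x) 2 (volume.restrict (tsupport φ)) := by
    obtain ⟨C, hC⟩ := hc.exists_bound_of_continuous hφ.continuous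
    refine MemLp.of_le_mul (c := C) h1 (h1.1.mul hφ.continuous.aestronglyMeasurable) ?_
    refine Eventually.of_forall fun x => ?_
    rw [norm_mul, mul_comm]
    exact mul_le_mul_of_nonneg_right (hC x) (norm_nonneg _)
  rw [← memLp_indicator_iff_restrict (isClosed_tsupport φ).measurableSet] at h2
  refine (congrArg (fun g => MemLp g 2 volume) (funext fun x => ?_)).mpr h2
  by_cases hx : x ∈ tsupport φ
  · simp [hx]
  · simp [hx, image_eq_zero_of_notMem_tsupport hx]

theorem memLp_test (φ : testFunctions n) : MemLp (φ : Space n → ℂ) 2 volume :=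
  φ.2.1.continuous.memLp_of_hasCompactSupport φ.2.2

theorem memLp_partialDeriv (φ : testFunctions n) (j : Fin n) :
    MemLp (partialDeriv (φ : Space n → ℂ) j) 2 volume :=
  ((φ.2.1.continuous_fderiv (by simp)).clm_apply continuous_const).memLp_of_hasCompactSupport
    (φ.2.2.fderiv_apply ℝ _)

theorem memLp_magneticPartial (ha : VecLocMemLp 2 a) (φ : testFunctions n) (j : Fin n) :
    MemLp (magneticPartial a (φ : Space n → ℂ) j) 2 volume := by
  have h := (memLp_partialDeriv φ j).add (((ha j).memLp_mul φ).const_mul Complex.I)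
  convert h using 1
  ext x
  simp [magneticPartial, mul_assoc]

theorem locMemLp_sqrt (hV : LocallyIntegrable V volume) (hV0 : ∀ᵐ x, 0 ≤ V x) :
    LocMemLp 2 (fun x => √(V x)) := by
  intro K hK
  have hi := hV.integrableOn_isCompact hK
  have hm : AEStronglyMeasurable (fun x => √(V x)) (volume.restrict K) :=
    (Real.continuous_sqrt.measurable.comp_aemeasurable hi.aemeasurable).aestronglyMeasurable
  rw [memLp_two_iff_integrable_sq hm]
  refine hi.congr ?_
  filter_upwards [ae_restrict_of_ae hV0] with x hx
  rw [Real.sq_sqrt hx]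

/-- The components of `(∇_a φ, √V φ)`. -/
def component (a : Space n → Space n) (V : Space n → ℝ) (o : Option (Fin n))
    (u : Space n → ℂ) (x : Space n) : ℂ :=
  match o with
  | none => (√(V x) : ℂ) * u x
  | some j => magneticPartial a u j x

theorem memLp_component (ha : VecLocMemLp 2 a) (hV : LocallyIntegrable V volume)
    (hV0 : ∀ᵐ x, 0 ≤ V x) (o : Option (Fin n)) (φ : testFunctions n) :
    MemLp (component a V o (φ : Space n → ℂ)) 2 volume := by
  cases o with
  | none => exact (locMemLp_sqrt hV hV0).memLp_mul φ
  | some j => exact memLp_magneticPartial ha φ j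

theorem component_add (o : Option (Fin n)) (φ ψ : testFunctions n) :
    component a V o ((φ + ψ : testFunctions n) : Space n → ℂ)
      = component a V o (φ : Space n → ℂ) + component a V o (ψ : Space n → ℂ) := by
  ext x
  have h1 : DifferentiableAt ℝ (φ : Space n → ℂ) x := (φ.2.1.differentiable (by simp)) x
  have h2 : DifferentiableAt ℝ (ψ : Space n → ℂ) x := (ψ.2.1.differentiable (by simp)) x
  cases o with
  | none => simp [component, mul_add]
  | some j =>
    simp only [component, magneticPartial, partialDeriv, Submodule.coe_add, Pi.add_apply]
    rw [fderiv_add h1 h2, _root_.add_apply]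
    ring

theorem component_smul (o : Option (Fin n)) (c : ℂ) (φ : testFunctions n) :
    component a V o ((c • φ : testFunctions n) : Space n → ℂ)
      = c • component a V o (φ : Space n → ℂ) := by
  ext x
  have h1 : DifferentiableAt ℝ (φ : Space n → ℂ) x := (φ.2.1.differentiable (by simp)) x
  cases o with
  | none => simp [component, mul_left_comm]
  | some j =>
    simp only [component, magneticPartial, partialDeriv, Submodule.coe_smul, Pi.smul_apply]
    rw [fderiv_const_smul h1, _root_.smul_apply]
    simp only [smul_eq_mul]
    ring

/-- `C_c^∞ → L²`. -/
def toL2 (n : ℕ) : testFunctions n →ₗ[ℂ] L2 n where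
  toFun φ := (memLp_test φ).toLp
  map_add' _ _ := rfl
  map_smul' _ _ := rfl

/-- `φ ↦ (∇_a φ, √V φ)` componentwise, as maps `C_c^∞ → L²`. -/
def componentL2 (ha : VecLocMemLp 2 a) (hV : LocallyIntegrable V volume)
    (hV0 : ∀ᵐ x, 0 ≤ V x) (o : Option (Fin n)) : testFunctions n →ₗ[ℂ] L2 n where
  toFun φ := (memLp_component ha hV hV0 o φ).toLp
  map_add' φ ψ := by
    rw [← MemLp.toLp_add]
    exact MemLp.toLp_congr _ _ (Eventually.of_forall fun x => by rw [component_add])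
  map_smul' c φ := by
    rw [RingHom.id_apply, ← MemLp.toLp_const_smul]
    exact MemLp.toLp_congr _ _ (Eventually.of_forall fun x => by rw [component_smul])

theorem inner_toLp_right {f : Space n → ℂ} (hf : MemLp f 2 volume) (g : L2 n) :
    inner ℂ (hf.toLp f) g = ∫ x, g x * conj (f x) := by
  rw [L2.inner_def]
  refine integral_congr_ae ?_
  filter_upwards [hf.coeFn_toLp] with x hx
  simp [hx, RCLike.inner_apply]

theorem inner_toLp_toLp {f g : Space n → ℂ} (hf : MemLp f 2 volume) (hg : MemLp g 2 volume) :
    inner ℂ (hf.toLp f) (hg.toLp g) = ∫ x, g x * conj (f x) := by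
  rw [inner_toLp_right]
  refine integral_congr_ae ?_
  filter_upwards [hg.coeFn_toLp] with x hx
  rw [hx]

theorem integrable_mul_conj {f g : Space n → ℂ} (hf : MemLp f 2 volume) (hg : MemLp g 2 volume) :
    Integrable (fun x => g x * conj (f x)) volume :=
  hg.integrable_mul hf.star

theorem magneticForm_eq (ha : VecLocMemLp 2 a) (hV : LocallyIntegrable V volume)
    (hV0 : ∀ᵐ x, 0 ≤ V x) (φ ψ : testFunctions n) :
    magneticForm a V φ ψ
      = ∑ o, inner ℂ (componentL2 ha hV hV0 o ψ) (componentL2 ha hV hV0 o φ) := by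
  have hi : ∀ o, Integrable (fun x => component a V o (φ : Space n → ℂ) x
      * conj (component a V o (ψ : Space n → ℂ) x)) volume := fun o =>
    integrable_mul_conj (memLp_component ha hV hV0 o ψ) (memLp_component ha hV hV0 o φ)
  have h1 : ∀ o, inner ℂ (componentL2 ha hV hV0 o ψ) (componentL2 ha hV hV0 o φ)
      = ∫ x, component a V o (φ : Space n → ℂ) x
          * conj (component a V o (ψ : Space n → ℂ) x) := fun o =>
    inner_toLp_toLp (memLp_component ha hV hV0 o ψ) (memLp_component ha hV hV0 o φ)
  simp_rw [h1]
  rw [← integral_finsetSum _ (fun o _ => hi o), magneticForm]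
  refine integral_congr_ae ?_
  filter_upwards [hV0] with x hx
  rw [Fintype.sum_option, add_comm]
  congr 1
  have : ((√(V x) : ℝ) : ℂ) * ((√(V x) : ℝ) : ℂ) = (V x : ℂ) := by
    rw [← Complex.ofReal_mul, Real.mul_self_sqrt hx]
  simp only [component, map_mul, Complex.conj_ofReal]
  rw [← this]
  ring

theorem magneticForm_self (ha : VecLocMemLp 2 a) (hV : LocallyIntegrable V volume)
    (hV0 : ∀ᵐ x, 0 ≤ V x) (φ : testFunctions n) :
    magneticForm a V φ φ = ((∑ o, ‖componentL2 ha hV hV0 o φ‖ ^ 2 : ℝ) : ℂ) := by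
  rw [magneticForm_eq ha hV hV0]
  push_cast
  refine Finset.sum_congr rfl fun o _ => ?_
  rw [inner_self_eq_norm_sq_to_K]
  rfl

theorem isOperatorPair_iff (ha : VecLocMemLp 2 a) (hV : LocallyIntegrable V volume)
    (hV0 : ∀ᵐ x, 0 ≤ V x) (u f : L2 n) :
    IsOperatorPair a V u f ↔ ∃ φ : ℕ → testFunctions n,
      Tendsto (fun k => toL2 n (φ k)) atTop (𝓝 u) ∧
      (∀ o, CauchySeq fun k => componentL2 ha hV hV0 o (φ k)) ∧
      ∀ ψ, Tendsto (fun k => ∑ o, inner ℂ (componentL2 ha hV hV0 o ψ)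
        (componentL2 ha hV hV0 o (φ k))) atTop (𝓝 (inner ℂ (toL2 n ψ) f)) := by
  refine exists_congr fun φ => and_congr ?_ (and_congr ?_ (forall_congr' fun ψ => ?_))
  · rw [tendsto_iff_edist_tendsto_0]
    refine tendsto_congr fun k => ?_
    rw [Lp.edist_def]
    refine eLpNorm_congr_ae ?_
    filter_upwards [(memLp_test (φ k)).coeFn_toLp] with x hx
    exact congrArg (· - _) hx.symm
  · have hself : ∀ q : ℕ × ℕ, magneticForm a V (φ q.1 - φ q.2 : testFunctions n)
        (φ q.1 - φ q.2 : testFunctions n)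
        = ((∑ o, ‖componentL2 ha hV hV0 o (φ q.1) - componentL2 ha hV hV0 o (φ q.2)‖ ^ 2 : ℝ)
          : ℂ) := fun q => by
      rw [magneticForm_self ha hV hV0]
      simp only [map_sub]
    simp_rw [hself]
    have hz : (0 : ℂ) = ((0 : ℝ) : ℂ) := by simp
    rw [hz, Filter.tendsto_ofReal_iff]
    constructor
    · intro h o
      rw [cauchySeq_iff_tendsto_dist_atTop_0]
      have h2 : Tendsto (fun q : ℕ × ℕ => ‖componentL2 ha hV hV0 o (φ q.1)
          - componentL2 ha hV hV0 o (φ q.2)‖ ^ 2) atTop (𝓝 0) := by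
        refine squeeze_zero (fun q => by positivity) (fun q => ?_) h
        exact Finset.single_le_sum (f := fun o => ‖componentL2 ha hV hV0 o (φ q.1)
          - componentL2 ha hV hV0 o (φ q.2)‖ ^ 2) (fun i _ => by positivity) (Finset.mem_univ o)
      have h3 := h2.sqrt
      simp only [Real.sqrt_zero, Real.sqrt_sq (norm_nonneg _)] at h3
      simpa only [dist_eq_norm] using h3
    · intro h
      have h2 : ∀ o ∈ (Finset.univ : Finset (Option (Fin n))),
          Tendsto (fun q : ℕ × ℕ => ‖componentL2 ha hV hV0 o (φ q.1)
          - componentL2 ha hV hV0 o (φ q.2)‖ ^ 2) atTop (𝓝 0) := fun o _ => by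
        have := (cauchySeq_iff_tendsto_dist_atTop_0.1 (h o)).pow 2
        simpa only [dist_eq_norm, ne_eq, OfNat.ofNat_ne_zero, not_false_eq_true, zero_pow]
          using this
      simpa using tendsto_finsetSum _ h2
  · simp_rw [magneticForm_eq ha hV hV0]
    rw [← inner_toLp_right (memLp_test ψ) f]
    rfl

/-- Formal adjoints of the components of `(∇_a, √V)`. -/
theorem inner_toL2_component (ha : VecLocMemLp 2 a) (hV : LocallyIntegrable V volume)
    (hV0 : ∀ᵐ x, 0 ≤ V x) (o : Option (Fin n)) (χ : testFunctions n) :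
    ∃ g : L2 n, ∀ φ : testFunctions n,
      inner ℂ (toL2 n χ) (componentL2 ha hV hV0 o φ) = inner ℂ g (toL2 n φ) := by
  cases o with
  | none =>
    refine ⟨componentL2 ha hV hV0 none χ, fun φ => ?_⟩
    refine (inner_toLp_toLp (memLp_test χ) (memLp_component ha hV hV0 none φ)).trans (Eq.trans ?_
      (inner_toLp_toLp (memLp_component ha hV hV0 none χ) (memLp_test φ)).symm)
    refine integral_congr_ae (Eventually.of_forall fun x => ?_)
    simp only [component, map_mul, Complex.conj_ofReal]
    ring
  | some j =>
    refine ⟨-componentL2 ha hV hV0 (some j) χ, fun φ => ?_⟩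
    rw [inner_neg_left]
    refine (inner_toLp_toLp (memLp_test χ) (memLp_component ha hV hV0 (some j) φ)).trans
      (Eq.trans ?_ (congrArg Neg.neg
        (inner_toLp_toLp (memLp_component ha hV hV0 (some j) χ) (memLp_test φ)).symm))
    simp only [component, magneticPartial]
    have hdχ : Differentiable ℝ (χ : Space n → ℂ) := χ.2.1.differentiable (by simp)
    have hdφ : Differentiable ℝ (φ : Space n → ℂ) := φ.2.1.differentiable (by simp)
    have hcd : ∀ x, partialDeriv (fun y => conj ((χ : Space n → ℂ) y)) j x
        = conj (partialDeriv (χ : Space n → ℂ) j x) := by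
      intro x
      have h := (Complex.conjCLE.toContinuousLinearMap.hasFDerivAt.comp x
        (hdχ x).hasFDerivAt).fderiv
      have h' : fderiv ℝ (fun y => conj ((χ : Space n → ℂ) y)) x
        = Complex.conjCLE.toContinuousLinearMap.comp (fderiv ℝ (χ : Space n → ℂ) x) := h
      simp [partialDeriv, h']
    have hA : Integrable (fun x => (a x j : ℂ) * (φ : Space n → ℂ) x
        * conj ((χ : Space n → ℂ) x)) volume :=
      integrable_mul_conj (memLp_test χ) ((ha j).memLp_mul φ)
    have h1 : Integrable (fun x => partialDeriv (φ : Space n → ℂ) j x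
        * conj ((χ : Space n → ℂ) x)) volume :=
      integrable_mul_conj (memLp_test χ) (memLp_partialDeriv φ j)
    have h2 : Integrable (fun x => (φ : Space n → ℂ) x
        * conj (partialDeriv (χ : Space n → ℂ) j x)) volume :=
      integrable_mul_conj (memLp_partialDeriv χ j) (memLp_test φ)
    have h3 : Integrable (fun x => (φ : Space n → ℂ) x
        * conj ((χ : Space n → ℂ) x)) volume :=
      integrable_mul_conj (memLp_test χ) (memLp_test φ)
    have hparts := integral_mul_fderiv_eq_neg_fderiv_mul_of_integrable
      (μ := (volume : Measure (Space n)))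
      (f := (φ : Space n → ℂ)) (g := fun y => conj ((χ : Space n → ℂ) y))
      (v := EuclideanSpace.single j (1 : ℝ)) h1
      (by simp only [← hcd] at h2; exact h2) h3 (fun x _ => hdφ x)
      (fun x _ => Complex.conjCLE.toContinuousLinearMap.differentiableAt.comp x (hdχ x))
    have hp : ∫ x, (φ : Space n → ℂ) x * conj (partialDeriv (χ : Space n → ℂ) j x)
        = - ∫ x, partialDeriv (φ : Space n → ℂ) j x * conj ((χ : Space n → ℂ) x) := by
      simp only [← hcd]
      exact hparts
    have e1 : ∀ x, (partialDeriv (φ : Space n → ℂ) j x + Complex.I * (a x j : ℂ)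
        * (φ : Space n → ℂ) x) * conj ((χ : Space n → ℂ) x)
        = partialDeriv (φ : Space n → ℂ) j x * conj ((χ : Space n → ℂ) x)
          + Complex.I * ((a x j : ℂ) * (φ : Space n → ℂ) x * conj ((χ : Space n → ℂ) x)) :=
      fun x => by ring
    have e2 : ∀ x, (φ : Space n → ℂ) x * conj (partialDeriv (χ : Space n → ℂ) j x
        + Complex.I * (a x j : ℂ) * (χ : Space n → ℂ) x)
        = (φ : Space n → ℂ) x * conj (partialDeriv (χ : Space n → ℂ) j x)
          - Complex.I * ((a x j : ℂ) * (φ : Space n → ℂ) x * conj ((χ : Space n → ℂ) x)) :=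
      fun x => by
        simp only [map_add, map_mul, Complex.conj_I, Complex.conj_ofReal]
        ring
    simp_rw [e1, e2]
    rw [integral_add h1 (hA.const_mul _), integral_sub h2 (hA.const_mul _), hp]
    ring

/-- `C_c^∞(ℝⁿ)` is dense in `L²(ℝⁿ)`. -/
theorem eq_zero_of_inner_test (f : L2 n) (h : ∀ χ, inner ℂ (toL2 n χ) f = 0) : f = 0 := by
  rw [Lp.eq_zero_iff_ae_eq_zero]
  refine ae_eq_zero_of_integral_contDiff_smul_eq_zero
    ((Lp.memLp f).locallyIntegrable (by norm_num)) fun g hg hc => ?_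
  have h1 := h ⟨fun x => (g x : ℂ), Complex.ofRealCLM.contDiff.comp hg,
    hc.comp_left (g := fun t : ℝ => (t : ℂ)) (by simp)⟩
  have h2 := (inner_toLp_right (memLp_test ⟨fun x => (g x : ℂ),
    Complex.ofRealCLM.contDiff.comp hg,
    hc.comp_left (g := fun t : ℝ => (t : ℂ)) (by simp)⟩) f).symm.trans h1
  rw [← h2]
  refine integral_congr_ae (Eventually.of_forall fun x => ?_)
  simp [mul_comm]

/-- The form is closable, and the operator of its closure is single-valued. -/
theorem IsOperatorPair.eq_zero (ha : VecLocMemLp 2 a) (hV : LocallyIntegrable V volume)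
    (hV0 : ∀ᵐ x, 0 ≤ V x) {f : L2 n} (h : IsOperatorPair a V 0 f) : f = 0 := by
  obtain ⟨φ, h0, hc, hf⟩ := (isOperatorPair_iff ha hV hV0 _ _).1 h
  have hlim : ∀ o, Tendsto (fun k => componentL2 ha hV hV0 o (φ k)) atTop (𝓝 0) := by
    intro o
    obtain ⟨q, hq⟩ := cauchySeq_tendsto_of_complete (hc o)
    have : q = 0 := by
      refine eq_zero_of_inner_test q fun χ => ?_
      obtain ⟨g, hg⟩ := inner_toL2_component ha hV hV0 o χ
      have t1 := (tendsto_const_nhds (x := toL2 n χ)).inner (𝕜 := ℂ) hq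
      have t2 := (tendsto_const_nhds (x := g)).inner (𝕜 := ℂ) h0
      simp only [hg] at t1
      rw [inner_zero_right] at t2
      exact tendsto_nhds_unique t1 t2
    rwa [this] at hq
  refine eq_zero_of_inner_test f fun ψ => tendsto_nhds_unique (hf ψ) ?_
  have : ∀ o ∈ (Finset.univ : Finset (Option (Fin n))),
      Tendsto (fun k => inner ℂ (componentL2 ha hV hV0 o ψ)
        (componentL2 ha hV hV0 o (φ k))) atTop (𝓝 0) := fun o _ => by
    simpa using (tendsto_const_nhds (x := componentL2 ha hV hV0 o ψ)).inner (𝕜 := ℂ) (hlim o)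
  simpa using tendsto_finsetSum _ this

end WellDefined

/-- The graph of `H_{a,V}`. -/
def operatorGraph {n : ℕ} (a : Space n → Space n) (V : Space n → ℝ) (ha : VecLocMemLp 2 a)
    (hV : LocallyIntegrable V volume) (hV0 : ∀ᵐ x, 0 ≤ V x) : Submodule ℂ (L2 n × L2 n) where
  carrier := {p | IsOperatorPair a V p.1 p.2}
  zero_mem' := by
    refine (isOperatorPair_iff ha hV hV0 _ _).2 ⟨fun _ => 0, ?_, fun o => ?_, fun ψ => ?_⟩
    · simp
    · simpa using cauchySeq_const _
    · simp
  add_mem' := by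
    intro p q hp hq
    obtain ⟨φ, h1, h2, h3⟩ := (isOperatorPair_iff ha hV hV0 _ _).1 hp
    obtain ⟨χ, k1, k2, k3⟩ := (isOperatorPair_iff ha hV hV0 _ _).1 hq
    refine (isOperatorPair_iff ha hV hV0 _ _).2 ⟨fun k => φ k + χ k, ?_, fun o => ?_, fun ψ => ?_⟩
    · simpa using h1.add k1
    · simp only [map_add]
      exact (h2 o).add (k2 o)
    · simpa [inner_add_right, Finset.sum_add_distrib] using (h3 ψ).add (k3 ψ)
  smul_mem' := by
    intro c p hp
    obtain ⟨φ, h1, h2, h3⟩ := (isOperatorPair_iff ha hV hV0 _ _).1 hp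
    refine (isOperatorPair_iff ha hV hV0 _ _).2 ⟨fun k => c • φ k, ?_, fun o => ?_, fun ψ => ?_⟩
    · simpa using h1.const_smul c
    · simp only [map_smul]
      exact (uniformContinuous_const_smul c).comp_cauchySeq (h2 o)
    · simp only [map_smul, inner_smul_right, ← Finset.mul_sum, Prod.smul_snd]
      exact (h3 ψ).const_mul c

/-- The magnetic Schrödinger operator `H_{a,V}` in `L²(ℝⁿ)`, for `a ∈ L²_loc`, `V ∈ L¹_loc`,
`V ≥ 0`: the (unbounded) operator defined by the closure of the quadratic form `h_{a,V}`. -/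
def magneticSchrodinger {n : ℕ} (a : Space n → Space n) (V : Space n → ℝ)
    (ha : VecLocMemLp 2 a) (hV : LocallyIntegrable V volume) (hV0 : ∀ᵐ x, 0 ≤ V x) :
    L2 n →ₗ.[ℂ] L2 n :=
  (operatorGraph a V ha hV hV0).toLinearPMap

theorem mem_graph_magneticSchrodinger {n : ℕ} (a : Space n → Space n) (V : Space n → ℝ)
    (ha : VecLocMemLp 2 a) (hV : LocallyIntegrable V volume) (hV0 : ∀ᵐ x, 0 ≤ V x)
    (u f : L2 n) :
    (u, f) ∈ (magneticSchrodinger a V ha hV hV0).graph ↔ IsOperatorPair a V u f := by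
  rw [magneticSchrodinger, Submodule.toLinearPMap_graph_eq]
  · rfl
  · rintro ⟨x, y⟩ hx (rfl : x = 0)
    exact IsOperatorPair.eq_zero ha hV hV0 hx

/-! ### Spectrum of an unbounded operator -/

section Spectrum

variable {H : Type*} [NormedAddCommGroup H] [NormedSpace ℂ H]

/-- The resolvent set of an unbounded operator `A`: `A - z` is a bijection from the domain of `A`
onto the whole space, with bounded inverse. -/
def resolventSet (A : H →ₗ.[ℂ] H) : Set ℂ :=
  {z | ∃ R : H →L[ℂ] H,
    (∀ f, ∃ h : R f ∈ A.domain, A ⟨R f, h⟩ - z • R f = f) ∧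
    ∀ u : A.domain, R (A u - z • (u : H)) = u}

/-- The spectrum of an unbounded operator. -/
def operatorSpectrum (A : H →ₗ.[ℂ] H) : Set ℂ := (resolventSet A)ᶜ

/-- The kernel of `A - z`. -/
def eigenspace (A : H →ₗ.[ℂ] H) (z : ℂ) : Submodule ℂ A.domain :=
  LinearMap.ker (A.toFun - z • A.domain.subtype)

/-- The spectrum consists of isolated eigenvalues of finite multiplicities. -/
def HasDiscreteSpectrum (A : H →ₗ.[ℂ] H) : Prop :=
  ∀ z ∈ operatorSpectrum A,
    (∃ r > 0, ∀ w ∈ operatorSpectrum A, dist w z < r → w = z) ∧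
    eigenspace A z ≠ ⊥ ∧ FiniteDimensional ℂ (eigenspace A z)

end Spectrum

/-! ### Cubes, capacity, the Molchanov functional and the local energy -/

/-- The closed cube `Q_d` with center `x`, edge length `d` and edges parallel to the axes. -/
def closedCube {n : ℕ} (x : Space n) (d : ℝ) : Set (Space n) := {y | ∀ j, |y j - x j| ≤ d / 2}

/-- The interior of the cube `Q_d` with center `x`. -/
def openCube {n : ℕ} (x : Space n) (d : ℝ) : Set (Space n) := {y | ∀ j, |y j - x j| < d / 2}

/-- The Wiener capacity of a compact set `F` relative to an open set `Ω`: the infimum of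
`∫ |∇u|² dx` over the Lipschitz functions `u` with compact support in `Ω` and `u = 1` on `F`
(Lipschitz functions are differentiable almost everywhere). -/
def wienerCapacity {n : ℕ} (Ω F : Set (Space n)) : ℝ≥0∞ :=
  ⨅ (u : Space n → ℂ) (_ : ∃ K, LipschitzWith K u) (_ : HasCompactSupport u)
    (_ : tsupport u ⊆ Ω) (_ : ∀ x ∈ F, u x = 1),
    ∫⁻ x, ∑ j, ‖partialDeriv u j x‖ₑ ^ 2

/-- `cap (F)` for compact `F ⊆ Q_d`, where `Q_d` has center `x`: the capacity relative to `ℝⁿ` if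
`n ≥ 3`, and relative to the interior of the concentric square `Q_{2d}` if `n = 2`. -/
def cubeCapacity {n : ℕ} (x : Space n) (d : ℝ) (F : Set (Space n)) : ℝ≥0∞ :=
  wienerCapacity (if n = 2 then openCube x (2 * d) else univ) F

/-- The Molchanov functional `M_c(Q_d; V)`, where `Q_d` has center `x`: the infimum of
`∫_{Q_d \ F} V dx` over the compact sets `F ⊆ Q_d` with `cap (F) ≤ c cap (Q_d)`. -/
def molchanov {n : ℕ} (c : ℝ) (x : Space n) (d : ℝ) (V : Space n → ℝ) : ℝ≥0∞ :=
  ⨅ (F : Set (Space n)) (_ : IsCompact F) (_ : F ⊆ closedCube x d)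
    (_ : cubeCapacity x d F ≤ ENNReal.ofReal c * cubeCapacity x d (closedCube x d)),
    ∫⁻ y in closedCube x d \ F, ENNReal.ofReal (V y)

/-- The bottom `μ(G; H_{a,V})` of the Neumann spectrum in an open set `G`: the infimum of
`∫_G (|∇_a u|² + V |u|²) dx / ∫_G |u|² dx` over `u ∈ (C^∞(G) \ {0}) ∩ L²(G)`. -/
def neumannBottom {n : ℕ} (G : Set (Space n)) (a : Space n → Space n) (V : Space n → ℝ) : ℝ≥0∞ :=
  ⨅ (u : Space n → ℂ) (_ : ContDiffOn ℝ ∞ u G) (_ : MemLp u 2 (volume.restrict G))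
    (_ : ∃ x ∈ G, u x ≠ 0),
    (∫⁻ x in G, ((∑ j, ‖magneticPartial a u j x‖ₑ ^ 2) + ENNReal.ofReal (V x) * ‖u x‖ₑ ^ 2))
      / ∫⁻ x in G, ‖u x‖ₑ ^ 2

/-- The local energy `μ₀(Q_d) = μ(Q_d; H_{a,0})` of the magnetic field, where `Q_d` has
center `x`. -/
def localEnergy {n : ℕ} (a : Space n → Space n) (x : Space n) (d : ℝ) : ℝ≥0∞ :=
  neumannBottom (openCube x d) a (fun _ => 0)

end MagneticSchrodinger

end

/-! The operator is determined by its resolvent `(H + 1)⁻¹ = J J*`, where `J` embeds the form domain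
into `L²` (`isOperatorPair_iff_resolvent`). If `J` is compact, this resolvent is a compact symmetric
operator, and spectral theory turns its nonzero eigenvalues into a discrete spectrum of `H`
(`hasDiscreteSpectrum_of_resolvent`). Compactness of `J` follows if, for every `ε > 0`, the square
norm of a test function is at most `ε` times its square form norm plus finitely many squared linear
functionals (`isCompactOperator_of_finite_control`).

On a ball this is Rellich's argument: there `a` is bounded, so the magnetic energy and the `L²` norm
control the ordinary gradient, and Poincaré's inequality on a fine grid leaves only the means over
finitely many cubes (`exists_lintegral_near_le`).

Far away, the heart of the matter is an estimate on one cube (`exists_lintegral_openCube_le`). If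
`μ₀ + d⁻ⁿ M_c ≥ N`, then the mass of `φ` in `Q_d` is at most `A d² + 8 / N` times its energy in
`Q_{2d}`, with `A` independent of `d` and `N`. If `μ₀ ≥ N / 2`, this is the definition of the local
energy. Otherwise `d⁻ⁿ M_c ≥ N / 2`; let `τ²` be a quarter of the mean of `|φ|²` and look at the set
where `|φ| ≤ τ`. If its capacity is small, it is admissible for `M_c`, and off it `V |φ|² ≥ τ² V`.
If its capacity is large, then `(|φ| - τ)₊` vanishes on a large set; Maz'ya's inequality bounds its
mass by `d²` times its gradient energy, which the diamagnetic inequality bounds by the magnetic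
energy. The smallness of this last term comes from `d` alone, so `d` is fixed small before the
center of the cube goes to infinity.

Maz'ya's inequality itself comes from Poincaré's inequality: a cutoff of `m - w`, with `m` the mean
of `w`, is `m` times a competitor for the capacity of the zero set, so the energy of `w` controls
`m`. -/

noncomputable section

namespace MagneticSchrodinger

/-! ### Compact operators and discreteness of the spectrum. -/

section Compact

open Module.End

variable {H : Type*} [NormedAddCommGroup H] [InnerProductSpace ℂ H] [CompleteSpace H]

/-- Nonzero eigenvalues of a compact symmetric operator are isolated. -/
theorem exists_gap_of_hasEigenvalue {K : H →L[ℂ] H} (hK : IsCompactOperator K)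
    (hs : (K : H →ₗ[ℂ] H).IsSymmetric) {l : ℂ} (hl : l ≠ 0) :
    ∃ r > 0, ∀ m, HasEigenvalue (K : Module.End ℂ H) m → dist m l < r → m = l := by
  set E := Module.End.eigenspace (K : Module.End ℂ H) l with hE
  have hinv : ∀ v ∈ Eᗮ, K v ∈ Eᗮ := hs.invariant_orthogonalComplement_eigenspace l
  let S : Eᗮ →L[ℂ] Eᗮ := K.restrict hinv
  have hS : IsCompactOperator S := hK.restrict' hinv
  have hSl : ¬ HasEigenvalue (S : Module.End ℂ Eᗮ) l := by
    intro h
    obtain ⟨v, hv⟩ := h.exists_hasEigenvector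
    have h1 : K v = l • (v : H) := congrArg Subtype.val hv.apply_eq_smul
    have h2 : (v : H) ∈ E := mem_eigenspace_iff.2 h1
    have h3 : (v : H) = 0 := by
      have := v.2 v h2
      exact inner_self_eq_zero.1 this
    exact hv.2 (Subtype.ext h3)
  -- Fredholm alternative: `K - l` is bounded below on `Eᗮ`. Eigenvectors for `m ≠ l` lie in `Eᗮ`,
  -- and there `(K - l) v = (m - l) v`, so `1 ≤ c |m - l|`. The radius uses `c + 1` so that it is
  -- also positive when `c = 0`.
  obtain ⟨c, hc⟩ := hS.antilipschitz_of_not_hasEigenvalue hl hSl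
  refine ⟨((c : ℝ) + 1)⁻¹, by positivity, fun m hm hd => ?_⟩
  by_contra hne
  obtain ⟨v, hv⟩ := hm.exists_hasEigenvector
  have hKv : K v = m • v := hv.apply_eq_smul
  have hvE : v ∈ Eᗮ := by
    intro w hw
    exact hs.orthogonalFamily_eigenspaces (fun h => hne h.symm) ⟨w, hw⟩ ⟨v, hv.1⟩
  have h1 := hc.le_mul_dist (⟨v, hvE⟩ : Eᗮ) 0
  have h2 : (S - l • (1 : Eᗮ →L[ℂ] Eᗮ)) ⟨v, hvE⟩ = (m - l) • ⟨v, hvE⟩ := by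
    apply Subtype.ext
    change K v - l • v = (m - l) • v
    rw [hKv, sub_smul]
  rw [map_zero, dist_zero_right, dist_zero_right, h2, norm_smul] at h1
  have hv0 : 0 < ‖(⟨v, hvE⟩ : Eᗮ)‖ := norm_pos_iff.2 fun h => hv.2 (congrArg Subtype.val h)
  rw [dist_eq_norm] at hd
  have h3 : (c : ℝ) * ‖m - l‖ < 1 := by
    have : ((c : ℝ) + 1) * ‖m - l‖ < 1 := by
      calc _ < ((c : ℝ) + 1) * ((c : ℝ) + 1)⁻¹ := by gcongr
        _ = 1 := mul_inv_cancel₀ (by positivity)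
    nlinarith [norm_nonneg (m - l)]
  nlinarith

/-- An unbounded operator `A` such that `(A + 1)⁻¹` is compact and symmetric has discrete
spectrum. -/
theorem hasDiscreteSpectrum_of_resolvent {A : H →ₗ.[ℂ] H} {K : H →L[ℂ] H}
    (hK : IsCompactOperator K) (hs : (K : H →ₗ[ℂ] H).IsSymmetric)
    (hA : ∀ u f, (u, f) ∈ A.graph ↔ u = K (f + u)) : HasDiscreteSpectrum A := by
  have hdom : ∀ {u f}, u = K (f + u) → ∃ h : u ∈ A.domain, A ⟨u, h⟩ = f := by
    intro u f h
    obtain ⟨y, hy1, hy2⟩ := (LinearPMap.mem_graph_iff A).1 ((hA u f).2 h)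
    simp only at hy1 hy2
    subst hy1
    exact ⟨y.2, hy2⟩
  have hgr : ∀ u : A.domain, (u : H) = K (A u + u) := fun u => (hA _ _).1 (A.mem_graph u)
  have hne : ∀ z ∈ operatorSpectrum A, 1 + z ≠ 0 := by
    intro z hz h
    obtain rfl : z = -1 := by linear_combination h
    -- The point `-1` is in the resolvent set, with resolvent `K`.
    refine hz ⟨K, fun f => ?_, fun u => ?_⟩
    · obtain ⟨h1, h2⟩ := hdom (u := K f) (f := f - K f) (by simp)
      exact ⟨h1, by rw [h2]; simp⟩
    · simpa using (hgr u).symm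
  have hev : ∀ z ∈ operatorSpectrum A, HasEigenvalue (K : Module.End ℂ H) (1 + z)⁻¹ := by
    intro z hz
    have h0 := hne z hz
    refine (hK.hasEigenvalue_or_mem_resolventSet (inv_ne_zero h0)).resolve_right fun hr => hz ?_
    obtain ⟨S, hS⟩ := spectrum.mem_resolventSet_iff.1 hr
    set l := (1 + z)⁻¹ with hl
    have hlz : (1 + z) * l = 1 := mul_inv_cancel₀ h0
    have e1 : ∀ x, l • (S⁻¹ : (H →L[ℂ] H)ˣ).1 x - K ((S⁻¹ : (H →L[ℂ] H)ˣ).1 x) = x := by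
      intro x
      have := congrArg (fun B : H →L[ℂ] H => B x) S.mul_inv
      rw [hS] at this
      simpa [Algebra.algebraMap_eq_smul_one] using this
    have e2 : ∀ x, (S⁻¹ : (H →L[ℂ] H)ˣ).1 (l • x - K x) = x := by
      intro x
      have := congrArg (fun B : H →L[ℂ] H => B x) S.inv_mul
      rw [hS] at this
      simpa [Algebra.algebraMap_eq_smul_one] using this
    -- With `K = (A + 1)⁻¹` and `l = (1 + z)⁻¹`, formally `l - K = l (A - z) K`, whence `(A - z)⁻¹ =
    -- l (l - K)⁻¹ K`.
    refine ⟨l • ((S⁻¹ : (H →L[ℂ] H)ˣ).1 ∘L K), fun f => ?_, fun u => ?_⟩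
    · set u := (l • ((S⁻¹ : (H →L[ℂ] H)ˣ).1 ∘L K)) f with hu
      have hu' : l • u - K u = l • K f := by
        have := e1 (K f)
        rw [hu]
        simp only [_root_.smul_apply, ContinuousLinearMap.comp_apply, map_smul]
        rw [← smul_sub, this]
      have hu2 : u = K ((f + z • u) + u) := by
        have h1 : l • u = K u + l • K f := by rw [← hu']; abel
        have h2 : u = (1 + z) • K u + K f := by
          have := congrArg (fun y => (1 + z) • y) h1
          simpa [smul_smul, hlz, smul_add] using this
        rw [map_add, map_add, map_smul]
        nth_rewrite 1 [h2]
        module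
      obtain ⟨h1, h2⟩ := hdom hu2
      exact ⟨h1, by rw [h2]; simp⟩
    · have h1 := hgr u
      have h2 : l • K (A u - z • (u : H)) = l • (u : H) - K u := by
        have : K (A u - z • (u : H)) = (u : H) - (1 + z) • K u := by
          rw [map_sub, map_smul]
          nth_rewrite 2 [h1]
          rw [map_add]
          module
        rw [this, smul_sub, smul_smul, mul_comm, hlz, one_smul]
      simp only [_root_.smul_apply, ContinuousLinearMap.comp_apply]
      rw [← map_smul, h2, e2]
  intro z hz
  have h0 := hne z hz
  refine ⟨?_, ?_, ?_⟩
  · obtain ⟨r, hr, hgap⟩ := exists_gap_of_hasEigenvalue hK hs (inv_ne_zero h0)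
    -- Isolation is pulled back along this map, which is continuous at `z` and injective.
    have hcont : ContinuousAt (fun w : ℂ => (1 + w)⁻¹) z :=
      (continuousAt_const.add continuousAt_id).inv₀ h0
    obtain ⟨s, hs0, hs1⟩ := Metric.continuousAt_iff.1 hcont r hr
    refine ⟨s, hs0, fun w hw hd => ?_⟩
    have := inv_inj.1 (hgap _ (hev w hw) (hs1 hd))
    exact add_left_cancel this
  · obtain ⟨v, hv⟩ := (hev z hz).exists_hasEigenvector
    have hKv : K v = (1 + z)⁻¹ • v := hv.apply_eq_smul
    obtain ⟨h1, h2⟩ := hdom (u := v) (f := z • v) (by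
      rw [map_add, map_smul, hKv, smul_smul, ← add_smul, ← add_one_mul, add_comm z,
        mul_inv_cancel₀ h0, one_smul])
    intro hbot
    have hmem : (⟨v, h1⟩ : A.domain) ∈ eigenspace A z := by
      rw [eigenspace, LinearMap.mem_ker]
      change A ⟨v, h1⟩ - z • v = 0
      rw [h2, sub_self]
    rw [hbot, Submodule.mem_bot] at hmem
    exact hv.2 (congrArg Subtype.val hmem)
  · have hfin := ContinuousLinearMap.finite_dimensional_eigenspace hK _ (inv_ne_zero h0)
    let F : eigenspace A z →ₗ[ℂ] Module.End.eigenspace (K : H →ₗ[ℂ] H) (1 + z)⁻¹ :=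
      (A.domain.subtype ∘ₗ (eigenspace A z).subtype).codRestrict _ fun u => by
        rw [mem_eigenspace_iff]
        have h1 : A u - z • ((u : A.domain) : H) = 0 := u.2
        have h2 := hgr u
        rw [sub_eq_zero.1 h1, map_add, map_smul] at h2
        change K ((u : A.domain) : H) = (1 + z)⁻¹ • ((u : A.domain) : H)
        nth_rewrite 2 [h2]
        have h3 : z • K ((u : A.domain) : H) + K ((u : A.domain) : H)
            = (1 + z) • K ((u : A.domain) : H) := by module
        rw [h3, smul_smul, inv_mul_cancel₀ h0, one_smul]
    refine Module.Finite.of_injective F fun x y hxy => ?_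
    have : ((x : A.domain) : H) = ((y : A.domain) : H) := by
      exact congrArg (fun v : Module.End.eigenspace (K : H →ₗ[ℂ] H) (1 + z)⁻¹ => (v : H)) hxy
    exact Subtype.ext (Subtype.ext this)

/-- An operator which is small up to finitely many linear functionals of its values is compact. -/
theorem isCompactOperator_of_finite_control {E : Type*} [NormedAddCommGroup E]
    [InnerProductSpace ℂ E] [CompleteSpace E] (J : E →L[ℂ] H) {s : Set E} (hs : Dense s)
    (h : ∀ ε > 0, ∃ (ι : Type) (_ : Fintype ι) (v : ι → H),
      ∀ x ∈ s, ‖J x‖ ^ 2 ≤ ε * ‖x‖ ^ 2 + ∑ i, ‖(inner ℂ (v i) (J x) : ℂ)‖ ^ 2) :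
    IsCompactOperator J := by
  -- `J` is a norm limit of finite rank operators. Let `W` be the common kernel of the functionals
  -- `x ↦ (v i, J x)`. Its complement is finite dimensional, and `J` composed with the projection to
  -- `Wᗮ` differs from `J` by `J` on `W`, where the functionals vanish and the hypothesis with `(ε /
  -- 2) ^ 2` gives norm at most `ε / 2`.
  refine isClosed_setOfPred_isCompactOperator.closure_subset
    (Metric.mem_closure_iff.2 fun ε hε => ?_)
  obtain ⟨ι, _, v, hv⟩ := h ((ε / 2) ^ 2) (by positivity)
  have hv' : ∀ x, ‖J x‖ ^ 2 ≤ (ε / 2) ^ 2 * ‖x‖ ^ 2 + ∑ i, ‖(inner ℂ (v i) (J x) : ℂ)‖ ^ 2 := by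
    intro x
    have hc : IsClosed {x : E | ‖J x‖ ^ 2
        ≤ (ε / 2) ^ 2 * ‖x‖ ^ 2 + ∑ i, ‖(inner ℂ (v i) (J x) : ℂ)‖ ^ 2} :=
      isClosed_le (by fun_prop) (by fun_prop)
    exact hc.closure_subset_iff.2 hv (hs x)
  let L : E →L[ℂ] (ι → ℂ) := ContinuousLinearMap.pi fun i => innerSL ℂ (v i) ∘L J
  let W : Submodule ℂ E := L.ker
  have hW : IsClosed (W : Set E) := L.isClosed_ker
  have : CompleteSpace W := hW.completeSpace_coe
  have hfd : FiniteDimensional ℂ Wᗮ := by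
    let F : Wᗮ →ₗ[ℂ] (ι → ℂ) := L.toLinearMap ∘ₗ Wᗮ.subtype
    refine Module.Finite.of_injective F ?_
    rw [← LinearMap.ker_eq_bot, LinearMap.ker_eq_bot']
    intro x hx
    have hxW : (x : E) ∈ W := hx
    exact Subtype.ext (inner_self_eq_zero.1 (x.2 x hxW))
  refine ⟨J ∘L (Wᗮ.subtypeL ∘L Wᗮ.orthogonalProjectionOnto), ?_, ?_⟩
  · have : LocallyCompactSpace Wᗮ := @locallyCompact_of_proper _ _ (FiniteDimensional.proper ℂ Wᗮ)
    exact (isCompactOperator_of_locallyCompactSpace_dom Wᗮ.orthogonalProjectionOnto).clm_comp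
      (J ∘L Wᗮ.subtypeL)
  · rw [dist_eq_norm]
    refine lt_of_le_of_lt (ContinuousLinearMap.opNorm_le_bound _ (by positivity : 0 ≤ ε / 2)
      fun x => ?_) (half_lt_self hε)
    set y := x - (Wᗮ.orthogonalProjectionOnto x : E) with hy
    have hyW : y ∈ W := by
      have := Wᗮ.sub_starProjection_mem_orthogonal x
      rwa [Submodule.orthogonal_orthogonal] at this
    have hyn : ‖y‖ ≤ ‖x‖ := by
      have h1 : y = W.starProjection x := by
        have := W.starProjection_orthogonal_val x
        rw [Submodule.starProjection_apply] at this
        rw [hy, this, sub_sub_cancel]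
      rw [h1]
      exact W.norm_starProjection_apply_le x
    have hLy : ∀ i, (inner ℂ (v i) (J y) : ℂ) = 0 := fun i => congrFun hyW i
    have h2 := hv' y
    simp only [hLy, norm_zero, ne_eq, OfNat.ofNat_ne_zero, not_false_eq_true, zero_pow,
      Finset.sum_const_zero, add_zero] at h2
    have h3 : ‖J y‖ ≤ ε / 2 * ‖y‖ := by
      refine le_of_sq_le_sq ?_ (by positivity)
      nlinarith
    calc _ = ‖J y‖ := by simp [hy]
      _ ≤ ε / 2 * ‖y‖ := h3
      _ ≤ _ := by gcongr

end Compact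

/-! ### The closed form and its resolvent. -/

section Form

variable {n : ℕ} {a : Space n → Space n} {V : Space n → ℝ}

/-- `φ ↦ (φ, ∇_a φ, √V φ)` as a map of `C_c^∞` to a sum of copies of `L²`. -/
def formMap (ha : VecLocMemLp 2 a) (hV : LocallyIntegrable V volume) (hV0 : ∀ᵐ x, 0 ≤ V x) :
    testFunctions n →ₗ[ℂ] PiLp 2 (fun _ : Option (Option (Fin n)) => L2 n) :=
  (WithLp.linearEquiv 2 ℂ (Option (Option (Fin n)) → L2 n)).symm.toLinearMap ∘ₗ
    LinearMap.pi fun o => o.elim (toL2 n) (componentL2 ha hV hV0)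

/-- The domain of the closed form, realised as a closed subspace of a sum of copies of `L²`. -/
def formDomain (ha : VecLocMemLp 2 a) (hV : LocallyIntegrable V volume) (hV0 : ∀ᵐ x, 0 ≤ V x) :
    Submodule ℂ (PiLp 2 (fun _ : Option (Option (Fin n)) => L2 n)) :=
  (LinearMap.range (formMap ha hV hV0)).topologicalClosure

instance (ha : VecLocMemLp 2 a) (hV : LocallyIntegrable V volume) (hV0 : ∀ᵐ x, 0 ≤ V x) :
    CompleteSpace (formDomain ha hV hV0) :=
  (Submodule.isClosed_topologicalClosure _).completeSpace_coe

/-- The embedding of the form domain into `L²`. -/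
def formEmbedding (ha : VecLocMemLp 2 a) (hV : LocallyIntegrable V volume)
    (hV0 : ∀ᵐ x, 0 ≤ V x) : formDomain ha hV hV0 →L[ℂ] L2 n :=
  PiLp.proj 2 (fun _ : Option (Option (Fin n)) => L2 n) none ∘L (formDomain ha hV hV0).subtypeL

/-- `C_c^∞` as a subspace of the form domain. -/
def formCore (ha : VecLocMemLp 2 a) (hV : LocallyIntegrable V volume) (hV0 : ∀ᵐ x, 0 ≤ V x)
    (φ : testFunctions n) : formDomain ha hV hV0 :=
  ⟨formMap ha hV hV0 φ, subset_closure ⟨φ, rfl⟩⟩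

theorem denseRange_formCore (ha : VecLocMemLp 2 a) (hV : LocallyIntegrable V volume)
    (hV0 : ∀ᵐ x, 0 ≤ V x) : DenseRange (formCore ha hV hV0) := by
  intro w
  have hw : (w : PiLp 2 (fun _ : Option (Option (Fin n)) => L2 n))
      ∈ closure (LinearMap.range (formMap ha hV hV0) : Set _) := w.2
  rw [closure_subtype]
  have hr : Subtype.val '' range (formCore ha hV hV0)
      = (LinearMap.range (formMap ha hV hV0) : Set _) := by
    rw [← range_comp]
    rfl
  rwa [hr]

theorem inner_formCore (ha : VecLocMemLp 2 a) (hV : LocallyIntegrable V volume)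
    (hV0 : ∀ᵐ x, 0 ≤ V x) (φ : testFunctions n) (w : formDomain ha hV hV0) :
    inner ℂ (formCore ha hV hV0 φ) w = inner ℂ (toL2 n φ) (w.1 none)
      + ∑ o, inner ℂ (componentL2 ha hV hV0 o φ) (w.1 (some o)) := by
  rw [Submodule.coe_inner, PiLp.inner_apply, Fintype.sum_option]
  rfl

/-- The operator of the closed form is determined by `(H + 1)⁻¹ = J J*`, where `J` is the
embedding of the form domain into `L²`. -/
theorem isOperatorPair_iff_resolvent (ha : VecLocMemLp 2 a) (hV : LocallyIntegrable V volume)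
    (hV0 : ∀ᵐ x, 0 ≤ V x) (u f : L2 n) :
    IsOperatorPair a V u f ↔ u = (formEmbedding ha hV hV0 ∘L
      ContinuousLinearMap.adjoint (formEmbedding ha hV hV0)) (f + u) := by
  set J := formEmbedding ha hV hV0 with hJ
  rw [isOperatorPair_iff ha hV hV0]
  constructor
  · rintro ⟨φ, h1, h2, h3⟩
    have h4 : ∀ o, ∃ q, Tendsto (fun k => componentL2 ha hV hV0 o (φ k)) atTop (𝓝 q) := fun o =>
      cauchySeq_tendsto_of_complete (h2 o)
    choose q hq using h4
    have hlim : Tendsto (fun k => formMap ha hV hV0 (φ k)) atTop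
        (𝓝 (WithLp.toLp 2 (fun o : Option (Option (Fin n)) => o.elim u q))) := by
      have : Tendsto (fun k => WithLp.ofLp (formMap ha hV hV0 (φ k))) atTop
          (𝓝 (fun o : Option (Option (Fin n)) => o.elim u q)) := by
        refine tendsto_pi_nhds.2 fun o => ?_
        cases o with
        | none => exact h1
        | some o => exact hq o
      exact ((PiLp.continuous_toLp 2 _).tendsto _).comp this
    let w : formDomain ha hV hV0 := ⟨_, mem_closure_of_tendsto hlim
      (Eventually.of_forall fun k => ⟨φ k, rfl⟩)⟩
    -- Tested on the dense core, this identity is the variational equation `(u,ψ) + h(u,ψ) = (f +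
    -- u,ψ)`.
    have hw : w = ContinuousLinearMap.adjoint J (f + u) := by
      refine (denseRange_formCore ha hV hV0).eq_of_inner_right (𝕜 := ℂ) fun ψ => ?_
      rw [ContinuousLinearMap.adjoint_inner_right, inner_formCore, add_comm, hJ]
      refine Eq.trans ?_ (inner_add_right (𝕜 := ℂ) (toL2 n ψ) f u).symm
      congr 1
      exact tendsto_nhds_unique
        (tendsto_finsetSum _ fun o _ => tendsto_const_nhds.inner (hq o)) (h3 ψ)
    rw [ContinuousLinearMap.comp_apply, ← hw]
    rfl
  · intro h
    set w := ContinuousLinearMap.adjoint J (f + u) with hw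
    have hin : ∀ ψ, inner ℂ (formCore ha hV hV0 ψ) w = inner ℂ (toL2 n ψ) (f + u) := fun ψ => by
      rw [hw, ContinuousLinearMap.adjoint_inner_right]
      rfl
    -- Conversely, any sequence of test functions approximating `w = J* (f + u)` in the form norm
    -- witnesses the operator pair.
    obtain ⟨x, hx, hxl⟩ := mem_closure_iff_seq_limit.1 w.2
    choose φ hφ using hx
    have hcomp : ∀ o, Tendsto (fun k => formMap ha hV hV0 (φ k) o) atTop (𝓝 (w.1 o)) := by
      intro o
      simp_rw [hφ]
      exact ((PiLp.continuous_apply 2 _ o).tendsto _).comp hxl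
    have hu : w.1 none = u := h.symm
    refine ⟨φ, ?_, fun o => (hcomp (some o)).cauchySeq, fun ψ => ?_⟩
    · rw [← hu]
      exact hcomp none
    · have h5 := hin ψ
      rw [inner_formCore, hu, inner_add_right, add_comm, add_right_cancel_iff] at h5
      rw [← h5]
      exact tendsto_finsetSum _ fun o _ => tendsto_const_nhds.inner (hcomp (some o))

theorem hasDiscreteSpectrum_of_isCompactOperator (ha : VecLocMemLp 2 a)
    (hV : LocallyIntegrable V volume) (hV0 : ∀ᵐ x, 0 ≤ V x)
    (h : IsCompactOperator (formEmbedding ha hV hV0)) :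
    HasDiscreteSpectrum (magneticSchrodinger a V ha hV hV0) := by
  refine hasDiscreteSpectrum_of_resolvent
    (h.comp_clm (ContinuousLinearMap.adjoint (formEmbedding ha hV hV0))) ?_ fun u f => by
      rw [mem_graph_magneticSchrodinger, isOperatorPair_iff_resolvent ha hV hV0]
  intro x y
  change inner ℂ (formEmbedding ha hV hV0 (ContinuousLinearMap.adjoint _ x)) y
    = inner ℂ x (formEmbedding ha hV hV0 (ContinuousLinearMap.adjoint _ y))
  rw [← ContinuousLinearMap.adjoint_inner_right, ContinuousLinearMap.adjoint_inner_left]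

/-- The criterion for discreteness of the spectrum in terms of the quadratic form. -/
theorem hasDiscreteSpectrum_of_finite_control (ha : VecLocMemLp 2 a)
    (hV : LocallyIntegrable V volume) (hV0 : ∀ᵐ x, 0 ≤ V x)
    (h : ∀ ε > 0, ∃ (ι : Type) (_ : Fintype ι) (v : ι → L2 n), ∀ φ : testFunctions n,
      ‖toL2 n φ‖ ^ 2 ≤ ε * (‖toL2 n φ‖ ^ 2 + ∑ o, ‖componentL2 ha hV hV0 o φ‖ ^ 2)
        + ∑ i, ‖(inner ℂ (v i) (toL2 n φ) : ℂ)‖ ^ 2) :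
    HasDiscreteSpectrum (magneticSchrodinger a V ha hV hV0) := by
  refine hasDiscreteSpectrum_of_isCompactOperator ha hV hV0
    (isCompactOperator_of_finite_control _ (denseRange_formCore ha hV hV0) fun ε hε => ?_)
  obtain ⟨ι, hι, v, hv⟩ := h ε hε
  refine ⟨ι, hι, v, ?_⟩
  rintro _ ⟨φ, rfl⟩
  have h1 : ‖formCore ha hV hV0 φ‖ ^ 2
      = ‖toL2 n φ‖ ^ 2 + ∑ o, ‖componentL2 ha hV hV0 o φ‖ ^ 2 := by
    rw [Submodule.coe_norm, PiLp.norm_sq_eq_of_L2, Fintype.sum_option]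
    rfl
  rw [h1]
  exact hv φ

end Form

/-! ### Poincaré's inequality for Lipschitz functions on convex sets. -/

section Poincare

variable {n : ℕ}

/-- `|∇u|²`. -/
def gradSq (u : Space n → ℂ) (x : Space n) : ℝ≥0∞ := ∑ j, ‖partialDeriv u j x‖ₑ ^ 2

theorem measurable_gradSq (u : Space n → ℂ) : Measurable (gradSq u) :=
  Finset.measurable_sum _ fun _ _ => (measurable_fderiv_apply_const ℝ u _).enorm.pow_const 2

theorem norm_fderiv_apply_sq_le (u : Space n → ℂ) (x v : Space n) :
    ‖fderiv ℝ u x v‖ ^ 2 ≤ ‖v‖ ^ 2 * ∑ j, ‖partialDeriv u j x‖ ^ 2 := by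
  have hv : v = ∑ j, v j • EuclideanSpace.single j (1 : ℝ) := by
    have := ((EuclideanSpace.basisFun (Fin n) ℝ).sum_repr v).symm
    simpa using this
  have h1 : fderiv ℝ u x v = ∑ j, v j • partialDeriv u j x := by
    conv_lhs => rw [hv]
    simp only [map_sum, map_smul]
    rfl
  have h2 : ‖fderiv ℝ u x v‖ ≤ ∑ j, ‖v j‖ * ‖partialDeriv u j x‖ := by
    rw [h1]
    exact (norm_sum_le _ _).trans (Finset.sum_le_sum fun j _ => (norm_smul _ _).le)
  calc ‖fderiv ℝ u x v‖ ^ 2 ≤ (∑ j, ‖v j‖ * ‖partialDeriv u j x‖) ^ 2 := by gcongr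
    _ ≤ (∑ j, ‖v j‖ ^ 2) * ∑ j, ‖partialDeriv u j x‖ ^ 2 :=
      Finset.sum_mul_sq_le_sq_mul_sq _ _ _
    _ = _ := by rw [EuclideanSpace.norm_sq_eq]

theorem enorm_sq_eq_ofReal {E : Type*} [SeminormedAddCommGroup E] (x : E) :
    ‖x‖ₑ ^ 2 = ENNReal.ofReal (‖x‖ ^ 2) := by
  rw [ENNReal.ofReal_pow (norm_nonneg _), ofReal_norm]

theorem gradSq_eq_ofReal (u : Space n → ℂ) (x : Space n) :
    gradSq u x = ENNReal.ofReal (∑ j, ‖partialDeriv u j x‖ ^ 2) := by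
  rw [ENNReal.ofReal_sum_of_nonneg fun _ _ => by positivity]
  simp only [gradSq, enorm_sq_eq_ofReal]

theorem enorm_fderiv_apply_sq_le (u : Space n → ℂ) (x v : Space n) :
    ‖fderiv ℝ u x v‖ₑ ^ 2 ≤ ‖v‖ₑ ^ 2 * gradSq u x := by
  rw [gradSq_eq_ofReal, enorm_sq_eq_ofReal, enorm_sq_eq_ofReal,
    ← ENNReal.ofReal_mul (by positivity)]
  exact ENNReal.ofReal_le_ofReal (norm_fderiv_apply_sq_le u x v)

theorem sq_lintegral_le {α : Type*} [MeasurableSpace α] (μ : Measure α) {f : α → ℝ≥0∞}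
    (hf : AEMeasurable f μ) : (∫⁻ x, f x ∂μ) ^ 2 ≤ μ univ * ∫⁻ x, f x ^ 2 ∂μ := by
  have h := ENNReal.lintegral_mul_le_Lp_mul_Lq μ Real.HolderConjugate.two_two
    (f := fun _ => 1) aemeasurable_const hf
  simp only [Pi.mul_apply, one_mul, lintegral_one, ENNReal.rpow_ofNat, one_pow] at h
  calc _ ≤ (μ univ ^ (1 / 2 : ℝ) * (∫⁻ x, f x ^ 2 ∂μ) ^ (1 / 2 : ℝ)) ^ 2 := by gcongr
    _ = _ := by
      rw [mul_pow, ← ENNReal.rpow_natCast, ← ENNReal.rpow_natCast, ← ENNReal.rpow_mul,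
        ← ENNReal.rpow_mul]
      norm_num

/-- With `Δ` the increment of `γ`, the fundamental theorem of calculus is applied to the real
function `Re (conj Δ · γ)`, whose increment is `|Δ|²`. Dividing by `|Δ|` bounds `|Δ|` by the
integral of `|γ'|`, and Cauchy–Schwarz on `[0, 1]` finishes. -/
theorem enorm_sub_sq_le_lintegral_deriv {γ : ℝ → ℂ} {C : NNReal} (hγ : LipschitzWith C γ) :
    ‖γ 1 - γ 0‖ₑ ^ 2 ≤ ∫⁻ t in Icc (0 : ℝ) 1, ‖deriv γ t‖ₑ ^ 2 := by
  set Δ := γ 1 - γ 0 with hΔ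
  let ℓ : ℂ →L[ℝ] ℝ := Complex.reCLM ∘L (ContinuousLinearMap.mul ℝ ℂ (conj Δ))
  have hℓ : ∀ z, ‖ℓ z‖ ≤ ‖Δ‖ * ‖z‖ := fun z => by
    refine (Complex.abs_re_le_norm _).trans ?_
    simp
  have hg : LipschitzWith (‖ℓ‖₊ * C) (fun t => ℓ (γ t)) := ℓ.lipschitz.comp hγ
  have h1 := (hg.lipschitzOnWith
    (s := uIcc 0 1)).absolutelyContinuousOnInterval.integral_deriv_eq_sub
  have h2 : ℓ (γ 1) - ℓ (γ 0) = ‖Δ‖ ^ 2 := by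
    rw [← map_sub, ← hΔ]
    change (conj Δ * Δ).re = _
    rw [← Complex.normSq_eq_conj_mul_self, Complex.ofReal_re, Complex.normSq_eq_norm_sq]
  have h3 : ∀ᵐ t, ‖deriv (fun t => ℓ (γ t)) t‖ₑ ≤ ‖Δ‖ₑ * ‖deriv γ t‖ₑ := by
    filter_upwards [hγ.ae_differentiableAt] with t ht
    have : deriv (fun t => ℓ (γ t)) t = ℓ (deriv γ t) :=
      (ℓ.hasFDerivAt.comp_hasDerivAt t ht.hasDerivAt).deriv
    rw [this, ← ofReal_norm, ← ofReal_norm, ← ofReal_norm, ← ENNReal.ofReal_mul (norm_nonneg _)]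
    exact ENNReal.ofReal_le_ofReal (hℓ _)
  have h4 : ‖Δ‖ₑ * ‖Δ‖ₑ ≤ ‖Δ‖ₑ * ∫⁻ t in Icc (0 : ℝ) 1, ‖deriv γ t‖ₑ := by
    calc ‖Δ‖ₑ * ‖Δ‖ₑ = ‖∫ t in (0 : ℝ)..1, deriv (fun t => ℓ (γ t)) t‖ₑ := by
          rw [h1, h2, enorm_pow, enorm_norm, sq]
      _ ≤ ∫⁻ t in Icc (0 : ℝ) 1, ‖deriv (fun t => ℓ (γ t)) t‖ₑ := by
          rw [intervalIntegral.integral_of_le zero_le_one, ← integral_Icc_eq_integral_Ioc]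
          exact enorm_integral_le_lintegral_enorm _
      _ ≤ ∫⁻ t in Icc (0 : ℝ) 1, ‖Δ‖ₑ * ‖deriv γ t‖ₑ := lintegral_mono_ae (ae_restrict_of_ae h3)
      _ = _ := lintegral_const_mul _ (measurable_deriv γ).enorm
  by_cases h0 : Δ = 0
  · simp [h0]
  have h5 : ‖Δ‖ₑ ≤ ∫⁻ t in Icc (0 : ℝ) 1, ‖deriv γ t‖ₑ :=
    (ENNReal.mul_le_mul_iff_right (by simpa using h0) (by simp)).1 h4
  calc _ ≤ (∫⁻ t in Icc (0 : ℝ) 1, ‖deriv γ t‖ₑ) ^ 2 := by gcongr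
    _ ≤ _ := by
      refine (sq_lintegral_le _ (measurable_deriv γ).enorm.aemeasurable).trans ?_
      simp

/-- The Jacobian is `s⁻ⁿ`, which is at most `2ⁿ` because `s ≥ 1 / 2`. -/
theorem lintegral_comp_smul_add_le {f : Space n → ℝ≥0∞} (hf : Measurable f) {s : ℝ}
    (hs : 1 / 2 ≤ s) (p : Space n) : ∫⁻ y, f (s • y + p) ≤ 2 ^ n * ∫⁻ y, f y := by
  have hs0 : 0 < s := by linarith
  have h1 : ∫⁻ y, f (s • y + p) = ∫⁻ z, f (z + p) ∂(Measure.map (s • ·) volume) :=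
    (lintegral_map (hf.comp (measurable_add_const p)) (measurable_const_smul s)).symm
  rw [h1, Measure.map_addHaar_smul _ hs0.ne', lintegral_smul_measure, lintegral_add_right_eq_self,
    smul_eq_mul]
  gcongr
  rw [finrank_euclideanSpace_fin, abs_of_pos (by positivity), ← inv_pow,
    ENNReal.ofReal_pow (by positivity)]
  gcongr
  rw [ENNReal.ofReal_le_iff_le_toReal (by simp)]
  calc s⁻¹ ≤ (1 / 2 : ℝ)⁻¹ := by gcongr
    _ = _ := by norm_num

/-- Poincaré's inequality on a convex set, in terms of differences. -/
theorem lintegral_lintegral_sub_sq_le {u : Space n → ℂ} {C : NNReal} (hu : LipschitzWith C u)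
    {K : Set (Space n)} (hK : Convex ℝ K) (hm : MeasurableSet K) {D : ℝ≥0∞}
    (hD : ∀ x ∈ K, ∀ y ∈ K, ‖y - x‖ₑ ≤ D) :
    ∫⁻ x in K, ∫⁻ y in K, ‖u x - u y‖ₑ ^ 2
      ≤ D ^ 2 * (volume K * (2 ^ n * ∫⁻ x in K, gradSq u x)) := by
  set N := {x | DifferentiableAt ℝ u x} with hN
  have hNm : MeasurableSet N := measurableSet_of_differentiableAt ℝ u
  -- By Rademacher's theorem the added infinite value sits on a null set and does not change
  -- integrals. It makes the bound along segments hold for every pair of points, even if the segment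
  -- runs inside the set of non-differentiability.
  set g : Space n → ℝ≥0∞ := fun x => gradSq u x + Nᶜ.indicator (fun _ => ⊤) x with hg
  have hgm : Measurable g := (measurable_gradSq u).add (measurable_const.indicator hNm.compl)
  set G := K.indicator g with hG
  have hGm : Measurable G := hgm.indicator hm
  have hGint : ∫⁻ x, G x = ∫⁻ x in K, gradSq u x := by
    rw [hG, lintegral_indicator hm]
    refine lintegral_congr_ae (ae_restrict_of_ae ?_)
    filter_upwards [hu.ae_differentiableAt] with x hx
    have : x ∈ N := hx
    simp [hg, this]
  have hpt : ∀ x ∈ K, ∀ y ∈ K,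
      ‖u x - u y‖ₑ ^ 2 ≤ D ^ 2 * ∫⁻ t in Icc (0 : ℝ) 1, G ((1 - t) • x + t • y) := by
    intro x hx y hy
    have hlip : LipschitzWith (C * (‖x‖₊ + ‖y‖₊)) (fun t : ℝ => u ((1 - t) • x + t • y)) := by
      refine hu.comp (LipschitzWith.of_dist_le_mul fun s t => ?_)
      rw [dist_eq_norm, dist_eq_norm]
      have : (1 - s) • x + s • y - ((1 - t) • x + t • y) = (s - t) • (y - x) := by module
      rw [this, norm_smul, mul_comm]
      gcongr
      push_cast
      rw [add_comm]
      exact norm_sub_le _ _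
    have h1 := enorm_sub_sq_le_lintegral_deriv hlip
    simp only [sub_self, zero_smul, one_smul, zero_add, sub_zero, add_zero] at h1
    rw [← enorm_neg, neg_sub]
    refine h1.trans ?_
    rw [← lintegral_const_mul _ (by fun_prop)]
    refine setLIntegral_mono (by fun_prop) fun t ht => ?_
    have hmem : (1 - t) • x + t • y ∈ K := hK hx hy (by linarith [ht.2]) ht.1 (by ring)
    rw [hG, indicator_of_mem hmem, hg]
    by_cases hz : (1 - t) • x + t • y ∈ N
    · have hd : HasDerivAt (fun t : ℝ => (1 - t) • x + t • y) (y - x) t := by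
        have h3 : (fun t : ℝ => (1 - t) • x + t • y) = fun t : ℝ => t • (y - x) + x := by
          ext t : 1
          module
        rw [h3]
        simpa using ((hasDerivAt_id t).smul_const (y - x)).add_const x
      have hz' : DifferentiableAt ℝ u ((1 - t) • x + t • y) := hz
      have h2 : deriv (fun t : ℝ => u ((1 - t) • x + t • y)) t
          = fderiv ℝ u ((1 - t) • x + t • y) (y - x) :=
        (hz'.hasFDerivAt.comp_hasDerivAt t hd).deriv
      rw [h2]
      refine (enorm_fderiv_apply_sq_le _ _ _).trans ?_
      gcongr
      · exact hD x hx y hy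
      · exact le_self_add
    · by_cases hxy : y = x
      · subst hxy
        have h3 : (fun t : ℝ => u ((1 - t) • y + t • y)) = fun _ => u y := by
          ext t
          congr 1
          module
        simp [h3]
      · have hD0 : D ≠ 0 := by
          rintro rfl
          have := hD x hx y hy
          simp [sub_eq_zero, hxy] at this
        have : (1 - t) • x + t • y ∈ Nᶜ := hz
        simp only [indicator_of_mem this]
        simp [ENNReal.mul_top (pow_ne_zero 2 hD0)]
  -- One of `t` and `1 - t` is at least `1 / 2`; the change of variables is made in the point
  -- carrying that coefficient, so the Jacobian never degenerates.
  have hslice : ∀ t ∈ Icc (0 : ℝ) 1,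
      ∫⁻ x in K, ∫⁻ y in K, G ((1 - t) • x + t • y) ≤ volume K * (2 ^ n * ∫⁻ x, G x) := by
    have key : ∀ s : ℝ, 1 / 2 ≤ s → ∀ r : ℝ,
        ∫⁻ x in K, ∫⁻ y in K, G (r • x + s • y) ≤ volume K * (2 ^ n * ∫⁻ x, G x) := by
      intro s hs r
      calc _ ≤ ∫⁻ x in K, (2 ^ n * ∫⁻ x, G x) := by
            refine lintegral_mono fun x => (setLIntegral_le_lintegral _ _).trans ?_
            simp_rw [add_comm (r • x)]
            exact lintegral_comp_smul_add_le hGm hs _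
        _ = _ := by rw [setLIntegral_const, mul_comm]
    intro t ht
    rcases le_total (1 / 2) t with h | h
    · exact key t h _
    · rw [lintegral_lintegral_swap (by fun_prop)]
      simp_rw [add_comm (_ • _) (t • _)]
      exact key (1 - t) (by linarith) t
  calc _ ≤ ∫⁻ x in K, ∫⁻ y in K,
        D ^ 2 * ∫⁻ t in Icc (0 : ℝ) 1, G ((1 - t) • x + t • y) :=
        setLIntegral_mono' hm fun x hx => setLIntegral_mono' hm fun y hy => hpt x hx y hy
    _ = D ^ 2 * ∫⁻ x in K, ∫⁻ y in K, ∫⁻ t in Icc (0 : ℝ) 1, G ((1 - t) • x + t • y) := by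
        rw [← lintegral_const_mul _ (by fun_prop)]
        congr 1 with x
        rw [← lintegral_const_mul _ (by fun_prop)]
    _ = D ^ 2 * ∫⁻ t in Icc (0 : ℝ) 1, ∫⁻ x in K, ∫⁻ y in K, G ((1 - t) • x + t • y) := by
        congr 1
        have h1 : ∀ x, ∫⁻ y in K, ∫⁻ t in Icc (0 : ℝ) 1, G ((1 - t) • x + t • y)
            = ∫⁻ t in Icc (0 : ℝ) 1, ∫⁻ y in K, G ((1 - t) • x + t • y) := fun x =>
          lintegral_lintegral_swap (by fun_prop)
        simp_rw [h1]
        exact lintegral_lintegral_swap (by fun_prop)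
    _ ≤ D ^ 2 * ∫⁻ t in Icc (0 : ℝ) 1, (volume K * (2 ^ n * ∫⁻ x, G x)) := by
        gcongr 1
        exact setLIntegral_mono' measurableSet_Icc hslice
    _ = _ := by rw [hGint]; simp

/-- The mean over a set is at most as far from a constant as the function is on average. -/
theorem volume_mul_enorm_average_sub_sq_le {u : Space n → ℂ} {K : Set (Space n)}
    (hi : IntegrableOn u K) (h0 : volume K ≠ 0) (hfin : volume K ≠ ⊤) (c : ℂ) :
    volume K * ‖(⨍ x in K, u x) - c‖ₑ ^ 2 ≤ ∫⁻ x in K, ‖u x - c‖ₑ ^ 2 := by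
  have : Fact (volume K < ⊤) := ⟨hfin.lt_top⟩
  have h1 : (volume.real K : ℂ) * ((⨍ x in K, u x) - c) = ∫ x in K, (u x - c) := by
    rw [integral_sub hi (integrable_const c), setAverage_eq, setIntegral_const]
    have : (volume.real K : ℂ) ≠ 0 := by
      rw [Ne, Complex.ofReal_eq_zero, Measure.real, ENNReal.toReal_eq_zero_iff]
      tauto
    rw [mul_sub, Complex.real_smul, Complex.real_smul]
    push_cast
    field_simp
  have h2 : volume K * ‖(⨍ x in K, u x) - c‖ₑ ≤ ∫⁻ x in K, ‖u x - c‖ₑ := by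
    refine le_trans (le_of_eq ?_) (enorm_integral_le_lintegral_enorm _)
    rw [← h1, enorm_mul, ← ofReal_norm (volume.real K : ℂ), Complex.norm_real, Real.norm_eq_abs,
      abs_of_nonneg measureReal_nonneg, ofReal_measureReal hfin]
  have h3 := sq_lintegral_le (volume.restrict K) (f := fun x => ‖u x - c‖ₑ)
    (hi.1.sub aestronglyMeasurable_const).enorm
  rw [Measure.restrict_apply_univ] at h3
  refine (ENNReal.mul_le_mul_iff_right h0 hfin).1 ?_
  calc _ = (volume K * ‖(⨍ x in K, u x) - c‖ₑ) ^ 2 := by ring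
    _ ≤ (∫⁻ x in K, ‖u x - c‖ₑ) ^ 2 := by gcongr
    _ ≤ _ := h3

/-- Poincaré's inequality on a convex set. -/
theorem lintegral_sub_average_sq_le {u : Space n → ℂ} {C : NNReal} (hu : LipschitzWith C u)
    {K : Set (Space n)} (hK : Convex ℝ K) (hm : MeasurableSet K) (hi : IntegrableOn u K)
    (h0 : volume K ≠ 0) (hfin : volume K ≠ ⊤) {D : ℝ≥0∞}
    (hD : ∀ x ∈ K, ∀ y ∈ K, ‖y - x‖ₑ ≤ D) :
    ∫⁻ x in K, ‖u x - ⨍ y in K, u y‖ₑ ^ 2 ≤ 2 ^ n * D ^ 2 * ∫⁻ x in K, gradSq u x := by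
  refine (ENNReal.mul_le_mul_iff_right h0 hfin).1 ?_
  have hcont := hu.continuous
  rw [← lintegral_const_mul _ (by fun_prop)]
  calc _ ≤ ∫⁻ x in K, ∫⁻ y in K, ‖u x - u y‖ₑ ^ 2 := by
        refine lintegral_mono fun x => ?_
        have := volume_mul_enorm_average_sub_sq_le hi h0 hfin (u x)
        simp_rw [← enorm_neg (u x - _), neg_sub]
        exact this
    _ ≤ _ := lintegral_lintegral_sub_sq_le hu hK hm hD
    _ = _ := by ring

/-- Means over a convex set and over a subset of it are close. -/
theorem volume_mul_enorm_average_sub_average_sq_le {u : Space n → ℂ} {C : NNReal}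
    (hu : LipschitzWith C u) {K K' : Set (Space n)} (hK : Convex ℝ K) (hm : MeasurableSet K)
    (hi : IntegrableOn u K) (hfin : volume K ≠ ⊤) {D : ℝ≥0∞}
    (hD : ∀ x ∈ K, ∀ y ∈ K, ‖y - x‖ₑ ≤ D) (hsub : K' ⊆ K) (h0 : volume K' ≠ 0) :
    volume K' * ‖(⨍ x in K', u x) - ⨍ x in K, u x‖ₑ ^ 2
      ≤ 2 ^ n * D ^ 2 * ∫⁻ x in K, gradSq u x :=
  calc _ ≤ ∫⁻ x in K', ‖u x - ⨍ y in K, u y‖ₑ ^ 2 :=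
        volume_mul_enorm_average_sub_sq_le (hi.mono_set hsub) h0
          (ne_top_of_le_ne_top hfin (measure_mono hsub)) _
    _ ≤ ∫⁻ x in K, ‖u x - ⨍ y in K, u y‖ₑ ^ 2 := lintegral_mono_set hsub
    _ ≤ _ := lintegral_sub_average_sq_le hu hK hm hi
        (fun h => h0 (measure_mono_null hsub h)) hfin hD

theorem enorm_sq_le_two_mul {E : Type*} [SeminormedAddCommGroup E] (x y : E) :
    ‖x‖ₑ ^ 2 ≤ 2 * ‖x - y‖ₑ ^ 2 + 2 * ‖y‖ₑ ^ 2 := by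
  simp only [enorm_sq_eq_ofReal]
  rw [← ENNReal.ofReal_ofNat 2, ← ENNReal.ofReal_mul (by norm_num),
    ← ENNReal.ofReal_mul (by norm_num), ← ENNReal.ofReal_add (by positivity) (by positivity)]
  refine ENNReal.ofReal_le_ofReal ?_
  have h : ‖x‖ ≤ ‖x - y‖ + ‖y‖ := by simpa using norm_add_le (x - y) y
  nlinarith [sq_nonneg (‖x - y‖ - ‖y‖), norm_nonneg x]

end Poincare

/-! ### Geometry of cubes and Poincaré's inequality on them. -/

section Cubes

variable {n : ℕ}

theorem isOpen_openCube (x : Space n) (d : ℝ) : IsOpen (openCube x d) := by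
  simp only [openCube, ofPred_forall]
  exact isOpen_iInter_of_finite fun j => isOpen_lt (by fun_prop) continuous_const

theorem isClosed_closedCube (x : Space n) (d : ℝ) : IsClosed (closedCube x d) := by
  simp only [closedCube, ofPred_forall]
  exact isClosed_iInter fun j => isClosed_le (by fun_prop) continuous_const

theorem openCube_subset_closedCube (x : Space n) (d : ℝ) : openCube x d ⊆ closedCube x d :=
  fun _ hy j => (hy j).le

theorem closedCube_subset_openCube (x : Space n) {d e : ℝ} (h : d < e) :
    closedCube x d ⊆ openCube x e :=
  fun _ hy j => (hy j).trans_lt (by linarith)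

theorem openCube_mono (x : Space n) {d e : ℝ} (h : d ≤ e) : openCube x d ⊆ openCube x e :=
  fun _ hy j => (hy j).trans_le (by linarith)

theorem norm_le_sqrt_mul {v : Space n} {r : ℝ} (hr : 0 ≤ r) (h : ∀ j, |v j| ≤ r) :
    ‖v‖ ≤ √n * r := by
  rw [EuclideanSpace.norm_eq, ← Real.sqrt_sq hr, ← Real.sqrt_mul (Nat.cast_nonneg n)]
  refine Real.sqrt_le_sqrt ?_
  calc ∑ j, ‖v j‖ ^ 2 ≤ ∑ _j : Fin n, r ^ 2 := by
        refine Finset.sum_le_sum fun j _ => ?_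
        have := h j
        rw [Real.norm_eq_abs]
        gcongr
    _ = _ := by simp

theorem isCompact_closedCube (x : Space n) (d : ℝ) : IsCompact (closedCube x d) := by
  refine Metric.isCompact_of_isClosed_isBounded (isClosed_closedCube x d)
    (Metric.isBounded_closedBall (x := x) (r := √n * max (d / 2) 0) |>.subset fun y hy => ?_)
  rw [Metric.mem_closedBall, dist_eq_norm]
  exact norm_le_sqrt_mul (le_max_right _ _) fun j => (hy j).trans (le_max_left _ _)

theorem convex_openCube (x : Space n) (d : ℝ) : Convex ℝ (openCube x d) := by
  intro y hy z hz s t hs ht hst j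
  have h1 : (s • y + t • z) j - x j = s * (y j - x j) + t * (z j - x j) := by
    simp only [PiLp.add_apply, PiLp.smul_apply, smul_eq_mul]
    linear_combination (x j) * hst
  have hy' := abs_lt.1 (hy j)
  have hz' := abs_lt.1 (hz j)
  rw [h1, abs_lt]
  rcases eq_or_lt_of_le hs with rfl | hs
  · have : t = 1 := by linarith
    subst this
    constructor <;> linarith [hz'.1, hz'.2]
  · have e1 := mul_lt_mul_of_pos_left hy'.1 hs
    have e2 := mul_le_mul_of_nonneg_left hz'.1.le ht
    have e3 := mul_lt_mul_of_pos_left hy'.2 hs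
    have e4 := mul_le_mul_of_nonneg_left hz'.2.le ht
    have e5 : d / 2 = s * (d / 2) + t * (d / 2) := by rw [← add_mul, hst, one_mul]
    constructor <;> linarith

theorem openCube_enorm_sub_le (x : Space n) {d : ℝ} (hd : 0 ≤ d) :
    ∀ y ∈ openCube x d, ∀ z ∈ openCube x d, ‖z - y‖ₑ ≤ ENNReal.ofReal (√n * d) := by
  intro y hy z hz
  rw [← ofReal_norm]
  refine ENNReal.ofReal_le_ofReal (norm_le_sqrt_mul hd fun j => ?_)
  have h1 := abs_lt.1 (hy j)
  have h2 := abs_lt.1 (hz j)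
  rw [PiLp.sub_apply, abs_le]
  constructor <;> linarith [h1.1, h1.2, h2.1, h2.2]

theorem volume_openCube (x : Space n) {d : ℝ} (hd : 0 ≤ d) :
    volume (openCube x d) = ENNReal.ofReal (d ^ n) := by
  have h1 : openCube x d = (WithLp.ofLp : Space n → (Fin n → ℝ)) ⁻¹'
      (univ.pi fun j => Ioo (x j - d / 2) (x j + d / 2)) := by
    ext y
    simp only [openCube, mem_ofPred_eq, mem_preimage, mem_univ_pi, mem_Ioo, abs_lt]
    refine forall_congr' fun j => and_congr ?_ ?_ <;> constructor <;> intro h <;> linarith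
  rw [h1, (PiLp.volume_preserving_ofLp (Fin n)).measure_preimage
    (MeasurableSet.univ_pi fun _ => measurableSet_Ioo).nullMeasurableSet, volume_pi_pi]
  simp only [Real.volume_Ioo]
  rw [Finset.prod_congr rfl fun j _ => by rw [show x j + d / 2 - (x j - d / 2) = d by ring],
    Finset.prod_const, Finset.card_univ, Fintype.card_fin, ENNReal.ofReal_pow hd]

theorem volume_openCube_ne_zero (x : Space n) {d : ℝ} (hd : 0 < d) :
    volume (openCube x d) ≠ 0 := by
  rw [volume_openCube x hd.le]
  simpa using pow_pos hd n

theorem volume_openCube_ne_top (x : Space n) {d : ℝ} (hd : 0 ≤ d) :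
    volume (openCube x d) ≠ ⊤ := by
  rw [volume_openCube x hd]
  exact ENNReal.ofReal_ne_top

theorem integrableOn_openCube {u : Space n → ℂ} (hu : Continuous u) (x : Space n) (d : ℝ) :
    IntegrableOn u (openCube x d) :=
  (hu.continuousOn.integrableOn_compact (isCompact_closedCube x d)).mono_set
    (openCube_subset_closedCube x d)

theorem sqrt_mul_sq_ofReal (d : ℝ) (hd : 0 ≤ d) :
    ENNReal.ofReal (√n * d) ^ 2 = ENNReal.ofReal (n * d ^ 2) := by
  rw [← ENNReal.ofReal_pow (by positivity), mul_pow, Real.sq_sqrt (Nat.cast_nonneg n)]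

/-- Poincaré's inequality on a cube. -/
theorem openCube_lintegral_sub_average_sq_le {u : Space n → ℂ} {C : NNReal}
    (hu : LipschitzWith C u) (x : Space n) {d : ℝ} (hd : 0 < d) :
    ∫⁻ y in openCube x d, ‖u y - ⨍ z in openCube x d, u z‖ₑ ^ 2
      ≤ ENNReal.ofReal (2 ^ n * (n * d ^ 2)) * ∫⁻ y in openCube x d, gradSq u y := by
  have := lintegral_sub_average_sq_le hu (convex_openCube x d)
    (isOpen_openCube x d).measurableSet (integrableOn_openCube hu.continuous x d)
    (volume_openCube_ne_zero x hd) (volume_openCube_ne_top x hd.le)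
    (openCube_enorm_sub_le x hd.le)
  rw [sqrt_mul_sq_ofReal d hd.le] at this
  rwa [ENNReal.ofReal_mul (by positivity), ENNReal.ofReal_pow (zero_le_two (α := ℝ)),
    ENNReal.ofReal_ofNat]

/-- Means over a cube and over a subcube are close. -/
theorem openCube_average_sub_average_sq_le {u : Space n → ℂ} {C : NNReal}
    (hu : LipschitzWith C u) {x x' : Space n} {d d' : ℝ} (hd : 0 < d) (hd' : 0 < d')
    (hsub : openCube x' d' ⊆ openCube x d) :
    ENNReal.ofReal (d' ^ n) * ‖(⨍ z in openCube x' d', u z) - ⨍ z in openCube x d, u z‖ₑ ^ 2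
      ≤ ENNReal.ofReal (2 ^ n * (n * d ^ 2)) * ∫⁻ y in openCube x d, gradSq u y := by
  have := volume_mul_enorm_average_sub_average_sq_le hu (convex_openCube x d)
    (isOpen_openCube x d).measurableSet (integrableOn_openCube hu.continuous x d)
    (volume_openCube_ne_top x hd.le) (openCube_enorm_sub_le x hd.le) hsub
    (volume_openCube_ne_zero x' hd')
  rw [sqrt_mul_sq_ofReal d hd.le, volume_openCube x' hd'.le] at this
  rwa [ENNReal.ofReal_mul (by positivity), ENNReal.ofReal_pow (zero_le_two (α := ℝ)),
    ENNReal.ofReal_ofNat]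

theorem average_openCube_of_eqOn {u : Space n → ℂ} {x : Space n} {d : ℝ} (hd : 0 < d) {c : ℂ}
    (h : ∀ y ∈ openCube x d, u y = c) : ⨍ z in openCube x d, u z = c := by
  rw [setAverage_eq, setIntegral_congr_fun (isOpen_openCube x d).measurableSet h, ← setAverage_eq,
    setAverage_const (volume_openCube_ne_zero x hd) (volume_openCube_ne_top x hd.le)]

end Cubes

/-! ### Lower bounds for the capacity of a cube. -/

section Capacity

variable {n : ℕ}

/-- Means over growing cubes of a compactly supported function tend to zero. -/
theorem tendsto_average_openCube {u : Space n → ℂ} (hu : Integrable u) (hn : n ≠ 0)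
    (x : Space n) {d : ℝ} (hd : 0 < d) :
    Tendsto (fun k : ℕ => ⨍ z in openCube x (2 ^ k * d), u z) atTop (𝓝 0) := by
  have h1 : Tendsto (fun k : ℕ => (((2 : ℝ) ^ k * d) ^ n)⁻¹ * ∫ z, ‖u z‖) atTop (𝓝 0) := by
    have h2 : Tendsto (fun k : ℕ => ((2 : ℝ) ^ k * d) ^ n) atTop atTop :=
      (tendsto_pow_atTop hn).comp
        ((tendsto_pow_atTop_atTop_of_one_lt one_lt_two).atTop_mul_const hd)
    simpa using h2.inv_tendsto_atTop.mul_const (∫ z, ‖u z‖)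
  refine squeeze_zero_norm (fun k => ?_) h1
  have hk : 0 < 2 ^ k * d := by positivity
  rw [setAverage_eq, norm_smul, Measure.real, volume_openCube x hk.le,
    ENNReal.toReal_ofReal (by positivity), Real.norm_of_nonneg (by positivity)]
  gcongr
  exact (norm_integral_le_integral_norm _).trans
    (setIntegral_le_integral hu.norm (Eventually.of_forall fun _ => norm_nonneg _))

/-- The means of `u` over the concentric cubes of edge `2ᵏ d` start at `1` and tend to `0`. By
Poincaré's inequality the square of the `k`-th jump is at most a constant times `d^(2-n)
2^(-k(n-2))` times the energy. The jumps are therefore summable, and since they add up to at least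
`1` the energy cannot be small. -/
theorem capacity_lower_bound_high (hn : 3 ≤ n) {u : Space n → ℂ} {C : NNReal}
    (hu : LipschitzWith C u) (hc : HasCompactSupport u) {x : Space n} {d : ℝ} (hd : 0 < d)
    (h1 : ∀ y ∈ closedCube x d, u y = 1) :
    ENNReal.ofReal ((16 * (2 ^ n * (n * 4)) : ℝ)⁻¹ * d ^ (n - 2)) ≤ ∫⁻ y, gradSq u y := by
  set I := ∫⁻ y, gradSq u y with hI
  by_cases hItop : I = ⊤
  · rw [hItop]; exact le_top
  obtain ⟨p, rfl⟩ : ∃ p, n = p + 2 := ⟨n - 2, by omega⟩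
  set i := I.toReal with hi
  have hIi : I = ENNReal.ofReal i := (ENNReal.ofReal_toReal hItop).symm
  have hi0 : 0 ≤ i := ENNReal.toReal_nonneg
  set A : ℝ := 2 ^ (p + 2) * ((p + 2 : ℕ) * 4) with hA
  have hA0 : 0 < A := by positivity
  set m : ℕ → ℂ := fun k => ⨍ z in openCube x (2 ^ k * d), u z with hm
  have hm0 : m 0 = 1 := by
    simp only [hm, pow_zero, one_mul]
    exact average_openCube_of_eqOn hd fun y hy => h1 y (openCube_subset_closedCube x d hy)
  have hlim : Tendsto m atTop (𝓝 0) := tendsto_average_openCube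
    (hu.continuous.integrable_of_hasCompactSupport hc) (by omega) x hd
  set B := √(A * i / d ^ p) with hB
  have hstep : ∀ k, dist (m k) (m (k + 1)) ≤ B * (3 / 4) ^ k := by
    intro k
    have e1 := openCube_average_sub_average_sq_le hu (x := x) (x' := x) (d := 2 ^ (k + 1) * d)
      (d' := 2 ^ k * d) (by positivity) (by positivity) (openCube_mono x (by
        rw [pow_succ]; nlinarith [pow_pos (two_pos : (0 : ℝ) < 2) k]))
    have e2 : ENNReal.ofReal ((2 ^ k * d) ^ (p + 2) * ‖m k - m (k + 1)‖ ^ 2)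
        ≤ ENNReal.ofReal (2 ^ (p + 2) * ((p + 2 : ℕ) * (2 ^ (k + 1) * d) ^ 2) * i) := by
      rw [ENNReal.ofReal_mul (by positivity), ENNReal.ofReal_mul (by positivity),
        ← enorm_sq_eq_ofReal, ← hIi]
      exact e1.trans (by gcongr; exact setLIntegral_le_lintegral _ _)
    rw [ENNReal.ofReal_le_ofReal_iff (by positivity)] at e2
    have hs : 0 < (2 : ℝ) ^ k := by positivity
    have e3 : (2 ^ k) ^ p * d ^ p * ‖m k - m (k + 1)‖ ^ 2 ≤ A * i := by
      refine le_of_mul_le_mul_left ?_ (by positivity : (0 : ℝ) < (2 ^ k * d) ^ 2)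
      calc _ = (2 ^ k * d) ^ (p + 2) * ‖m k - m (k + 1)‖ ^ 2 := by ring
        _ ≤ _ := e2
        _ = _ := by rw [hA]; ring
    -- This is where `n ≥ 3`, that is `p ≥ 1`, gives geometric decay.
    have e4 : (2 : ℝ) ^ k ≤ (2 ^ k) ^ p :=
      le_self_pow₀ (one_le_pow₀ one_le_two) (by omega)
    have e5 : 2 ^ k * (d ^ p * ‖m k - m (k + 1)‖ ^ 2) ≤ A * i := by
      refine le_trans ?_ e3
      rw [mul_assoc]
      gcongr
    -- The ratio `1 / 2` is relaxed to `9 / 16`, which has the rational root `3 / 4`. The resulting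
    -- geometric series sums to `4`, hence the factor `16` in the constant.
    have e6 : ‖m k - m (k + 1)‖ ^ 2 ≤ A * i / d ^ p * (9 / 16) ^ k := by
      have : ‖m k - m (k + 1)‖ ^ 2 ≤ A * i / d ^ p * (1 / 2) ^ k := by
        rw [one_div, inv_pow, ← div_eq_mul_inv, div_div, le_div_iff₀ (by positivity)]
        linarith
      refine this.trans (mul_le_mul_of_nonneg_left ?_ (by positivity))
      exact pow_le_pow_left₀ (by norm_num) (by norm_num) k
    rw [dist_eq_norm]
    refine le_of_sq_le_sq ?_ (by positivity)
    rw [mul_pow, hB, Real.sq_sqrt (by positivity), ← pow_mul, mul_comm k 2, pow_mul]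
    norm_num at e6 ⊢
    exact e6
  have hfin := dist_le_of_le_geometric_of_tendsto₀ (3 / 4) B (by norm_num) hstep hlim
  rw [hm0, dist_zero_right, norm_one] at hfin
  have h16 : 1 ≤ 16 * (A * i / d ^ p) := by
    have h4B : 1 ≤ 4 * B := hfin.trans (le_of_eq (by ring))
    have : B ^ 2 = A * i / d ^ p := Real.sq_sqrt (by positivity)
    nlinarith
  rw [hIi]
  refine ENNReal.ofReal_le_ofReal ?_
  rw [Nat.add_sub_cancel]
  rw [← mul_div_assoc, le_div_iff₀ (by positivity), one_mul] at h16
  rw [inv_mul_le_iff₀ (by positivity)]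
  linarith

/-- In the plane the jumps of the means need not decay, but `u` vanishes off `Q_{2d}`: two squares
of edge `d` inside `Q_{4d}`, one with mean `1` and one with mean `0`, are both compared with the
mean over `Q_{4d}`. Each comparison costs `128` times the energy, and `2 · 128 + 2 · 128 = 512`. -/
theorem capacity_lower_bound_two (hn : n = 2) {u : Space n → ℂ} {C : NNReal}
    (hu : LipschitzWith C u) {x : Space n} {d : ℝ} (hd : 0 < d)
    (h0 : ∀ y ∉ openCube x (2 * d), u y = 0) (h1 : ∀ y ∈ closedCube x d, u y = 1) :
    ENNReal.ofReal (512⁻¹) ≤ ∫⁻ y, gradSq u y := by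
  subst hn
  set I := ∫⁻ y, gradSq u y with hI
  set m := ⨍ z in openCube x (4 * d), u z with hm
  -- Along the first axis this square spans the offsets from `d` to `2 * d`: just outside `Q_{2d}`
  -- and still inside `Q_{4d}`.
  set x' : Space 2 := x + EuclideanSpace.single 0 (3 / 2 * d) with hx'
  have hsub : openCube x' d ⊆ openCube x (4 * d) := by
    intro y hy j
    have := abs_lt.1 (hy j)
    have h3 : x' j = x j + if j = 0 then 3 / 2 * d else 0 := by
      simp [hx']
    rw [h3] at this
    rw [abs_lt]
    split_ifs at this <;> constructor <;> linarith [this.1, this.2]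
  have ha0 : ⨍ z in openCube x' d, u z = 0 := by
    refine average_openCube_of_eqOn hd fun y hy => h0 y fun hy2 => ?_
    have h3 := abs_lt.1 (hy 0)
    have h4 := abs_lt.1 (hy2 0)
    simp [hx'] at h3
    linarith [h3.1, h4.2]
  have ha1 : ⨍ z in openCube x d, u z = 1 :=
    average_openCube_of_eqOn hd fun y hy => h1 y (openCube_subset_closedCube x d hy)
  have e1 := openCube_average_sub_average_sq_le hu (by positivity : 0 < 4 * d) hd hsub
  have e2 := openCube_average_sub_average_sq_le hu (by positivity : 0 < 4 * d) hd
    (openCube_mono x (by linarith : d ≤ 4 * d))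
  rw [ha0] at e1
  rw [ha1] at e2
  have key : ∀ c : ℂ, ENNReal.ofReal (d ^ 2) * ‖c - m‖ₑ ^ 2
      ≤ ENNReal.ofReal (2 ^ 2 * ((2 : ℕ) * (4 * d) ^ 2)) * ∫⁻ y in openCube x (4 * d), gradSq u y →
      ‖c - m‖ₑ ^ 2 ≤ 128 * I := by
    intro c h
    have hd2 : (2 : ℝ) ^ 2 * ((2 : ℕ) * (4 * d) ^ 2) = d ^ 2 * 128 := by push_cast; ring
    rw [hd2, ENNReal.ofReal_mul (by positivity), mul_assoc, ENNReal.mul_le_mul_iff_right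
      (by simpa using hd.ne') ENNReal.ofReal_ne_top, ENNReal.ofReal_ofNat] at h
    exact h.trans (by gcongr; exact setLIntegral_le_lintegral _ _)
  have k0 := key 0 e1
  have k1 := key 1 e2
  rw [zero_sub, enorm_neg] at k0
  have k2 : (1 : ℝ≥0∞) ≤ 512 * I := by
    calc (1 : ℝ≥0∞) = ‖(1 : ℂ)‖ₑ ^ 2 := by simp
      _ ≤ 2 * ‖1 - m‖ₑ ^ 2 + 2 * ‖m‖ₑ ^ 2 := enorm_sq_le_two_mul _ _
      _ ≤ 2 * (128 * I) + 2 * (128 * I) := by gcongr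
      _ = 512 * I := by ring
  rw [ENNReal.ofReal_inv_of_pos (by norm_num), ENNReal.ofReal_ofNat]
  rw [ENNReal.inv_le_iff_le_mul (by simp) (by simp)]
  exact k2

theorem exists_le_cubeCapacity_closedCube (hn : 2 ≤ n) :
    ∃ κ : ℝ, 0 < κ ∧ ∀ (x : Space n) (d : ℝ), 0 < d →
      ENNReal.ofReal (κ * d ^ (n - 2)) ≤ cubeCapacity x d (closedCube x d) := by
  rcases hn.eq_or_lt with h2 | h3
  · refine ⟨512⁻¹, by norm_num, fun x d hd => ?_⟩
    simp only [cubeCapacity, wienerCapacity, le_iInf_iff]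
    rintro u ⟨C, hu⟩ - hs h1
    rw [Nat.sub_eq_zero_of_le h2.ge, pow_zero, mul_one]
    refine capacity_lower_bound_two h2.symm hu hd (fun y hy => ?_) h1
    rw [if_pos h2.symm] at hs
    exact image_eq_zero_of_notMem_tsupport fun h => hy (hs h)
  · refine ⟨(16 * (2 ^ n * (n * 4)))⁻¹, by positivity, fun x d hd => ?_⟩
    simp only [cubeCapacity, wienerCapacity, le_iInf_iff]
    rintro u ⟨C, hu⟩ hc - h1
    exact capacity_lower_bound_high h3 hu hc hd h1

end Capacity

/-! ### Maz'ya's inequality. -/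

section Mazya

variable {n : ℕ}

theorem lipschitzWith_mul_of_bounded {f : Space n → ℝ} {g : Space n → ℂ} {Cf Cg : NNReal}
    (hf : LipschitzWith Cf f) (hg : LipschitzWith Cg g) {Bf Bg : NNReal}
    (hBf : ∀ x, ‖f x‖ ≤ Bf) (hBg : ∀ x, ‖g x‖ ≤ Bg) :
    LipschitzWith (Bf * Cg + Bg * Cf) (fun x => (f x : ℂ) * g x) := by
  refine LipschitzWith.of_dist_le_mul fun x y => ?_
  rw [dist_eq_norm]
  have h1 : (f x : ℂ) * g x - f y * g y
      = (f x : ℂ) * (g x - g y) + ((f x - f y : ℝ) : ℂ) * g y := by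
    push_cast; ring
  rw [h1]
  refine (norm_add_le _ _).trans ?_
  rw [norm_mul, norm_mul, Complex.norm_real, Complex.norm_real]
  have e1 : ‖g x - g y‖ ≤ Cg * dist x y := by rw [← dist_eq_norm]; exact hg.dist_le_mul x y
  have e2 : ‖f x - f y‖ ≤ Cf * dist x y := by rw [← dist_eq_norm]; exact hf.dist_le_mul x y
  push_cast
  calc _ ≤ Bf * (Cg * dist x y) + (Cf * dist x y) * Bg := by
        gcongr
        · exact hBf x
        · exact hBg y
    _ = _ := by ring

/-- A Lipschitz cutoff which is `1` on `F` and vanishes at distance at least `δ` from `F`. -/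
def cutoff (F : Set (Space n)) (δ : ℝ) (y : Space n) : ℝ := max 0 (1 - δ⁻¹ * Metric.infDist y F)

theorem lipschitzWith_cutoff (F : Set (Space n)) {δ : ℝ} (hδ : 0 ≤ δ) :
    LipschitzWith (Real.toNNReal δ⁻¹) (cutoff F δ) := by
  refine LipschitzWith.const_max (LipschitzWith.of_dist_le_mul fun y z => ?_) 0
  have h := (Metric.lipschitz_infDist_pt F).dist_le_mul y z
  rw [Real.dist_eq] at h ⊢
  rw [Real.coe_toNNReal _ (by positivity)]
  have : 1 - δ⁻¹ * Metric.infDist y F - (1 - δ⁻¹ * Metric.infDist z F)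
      = -(δ⁻¹ * (Metric.infDist y F - Metric.infDist z F)) := by ring
  rw [this, abs_neg, abs_mul, abs_of_nonneg (inv_nonneg.2 hδ)]
  gcongr
  simpa using h

theorem cutoff_nonneg (F : Set (Space n)) (δ : ℝ) (y : Space n) : 0 ≤ cutoff F δ y :=
  le_max_left _ _

theorem cutoff_le_one (F : Set (Space n)) {δ : ℝ} (hδ : 0 ≤ δ) (y : Space n) :
    cutoff F δ y ≤ 1 := by
  have : 0 ≤ δ⁻¹ * Metric.infDist y F := mul_nonneg (inv_nonneg.2 hδ) Metric.infDist_nonneg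
  exact max_le zero_le_one (by linarith)

theorem cutoff_eq_one {F : Set (Space n)} {δ : ℝ} {y : Space n} (hy : y ∈ F) :
    cutoff F δ y = 1 := by
  simp [cutoff, Metric.infDist_zero_of_mem hy]

theorem mem_cthickening_of_cutoff_ne_zero {F : Set (Space n)} (hF : F.Nonempty) {δ : ℝ}
    (hδ : 0 < δ) {y : Space n} (hy : cutoff F δ y ≠ 0) : y ∈ Metric.cthickening δ F := by
  rw [Metric.cthickening_eq_preimage_infEDist, mem_preimage, mem_Iic]
  rw [← ENNReal.ofReal_toReal (Metric.infEDist_ne_top hF)]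
  refine ENNReal.ofReal_le_ofReal ?_
  change Metric.infDist y F ≤ δ
  by_contra! h
  refine hy (max_eq_left ?_)
  have := mul_lt_mul_of_pos_left h (inv_pos.2 hδ)
  rw [inv_mul_cancel₀ hδ.ne'] at this
  linarith

theorem cthickening_closedCube_subset (x : Space n) {d : ℝ} (hd : 0 < d) :
    Metric.cthickening (d / 4) (closedCube x d) ⊆ openCube x (2 * d) := by
  rw [(isCompact_closedCube x d).cthickening_eq_biUnion_closedBall (by positivity)]
  refine iUnion₂_subset fun z hz y hy j => ?_
  have h1 : |y j - z j| ≤ d / 4 := by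
    rw [Metric.mem_closedBall, dist_eq_norm] at hy
    exact (PiLp.norm_apply_le (y - z) j).trans hy
  have h2 := abs_le.1 (hz j)
  have h3 := abs_le.1 h1
  rw [abs_lt]
  constructor <;> linarith [h2.1, h2.2, h3.1, h3.2]

theorem gradSq_const_mul (c : ℂ) (u : Space n → ℂ) (x : Space n) :
    gradSq (fun y => c * u y) x = ‖c‖ₑ ^ 2 * gradSq u x := by
  have h : ∀ j, partialDeriv (fun y => c * u y) j x = c * partialDeriv u j x := by
    intro j
    have : fderiv ℝ (c • u) x = (c • fderiv ℝ u) x := congrFun (fderiv_const_smul_field c) x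
    exact congrArg (fun L : Space n →L[ℝ] ℂ => L (EuclideanSpace.single j 1)) this
  simp only [gradSq, h, enorm_mul, mul_pow, Finset.mul_sum]

/-- For `m ≠ 0` the function `v / m` is a competitor for the capacity, and the energy is quadratic.
-/
theorem enorm_sq_mul_wienerCapacity_le {Ω F : Set (Space n)} {v : Space n → ℂ} {C : NNReal}
    (hv : LipschitzWith C v) (hc : HasCompactSupport v) (hs : tsupport v ⊆ Ω) {m : ℂ}
    (hm : ∀ y ∈ F, v y = m) : ‖m‖ₑ ^ 2 * wienerCapacity Ω F ≤ ∫⁻ y, gradSq v y := by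
  by_cases h0 : m = 0
  · simp [h0]
  have hle : wienerCapacity Ω F ≤ ∫⁻ y, gradSq (fun y => m⁻¹ * v y) y := by
    refine iInf_le_of_le (fun y => m⁻¹ * v y) (iInf_le_of_le ?_ (iInf_le_of_le ?_
      (iInf_le_of_le ?_ (iInf_le_of_le ?_ le_rfl))))
    · exact ⟨_, (lipschitzWith_smul m⁻¹).comp hv⟩
    · exact hc.mul_left
    · exact (closure_mono (Function.support_mul_subset_right _ _)).trans hs
    · intro y hy
      simp only [hm y hy, inv_mul_cancel₀ h0]
  have hm0 : ‖m‖ₑ ≠ 0 := by simpa using h0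
  calc ‖m‖ₑ ^ 2 * wienerCapacity Ω F ≤ ‖m‖ₑ ^ 2 * ∫⁻ y, gradSq (fun y => m⁻¹ * v y) y := by
        gcongr
    _ = ‖m‖ₑ ^ 2 * (‖m⁻¹‖ₑ ^ 2 * ∫⁻ y, gradSq v y) := by
        simp only [gradSq_const_mul]
        rw [lintegral_const_mul _ (measurable_gradSq v)]
    _ = _ := by
        rw [← mul_assoc, ← mul_pow, ← enorm_mul, mul_inv_cancel₀ h0]
        simp

theorem partialDeriv_real_mul {f : Space n → ℝ} {g : Space n → ℂ} {x : Space n}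
    (hf : DifferentiableAt ℝ f x) (hg : DifferentiableAt ℝ g x) (j : Fin n) :
    partialDeriv (fun y => (f y : ℂ) * g y) j x
      = (fderiv ℝ f x (EuclideanSpace.single j 1) : ℂ) * g x + f x * partialDeriv g j x := by
  have h1 : HasFDerivAt (fun y => f y • g y) _ x := hf.hasFDerivAt.smul hg.hasFDerivAt
  have h2 : (fun y => (f y : ℂ) * g y) = fun y => f y • g y := by
    ext y
    rw [Complex.real_smul]
  rw [partialDeriv, h2, h1.fderiv]
  simp [partialDeriv, add_comm]

theorem gradSq_real_mul_le {f : Space n → ℝ} {g : Space n → ℂ} {C : NNReal}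
    (hf : LipschitzWith C f) {x : Space n} (hfd : DifferentiableAt ℝ f x)
    (hgd : DifferentiableAt ℝ g x) (hf1 : |f x| ≤ 1) :
    gradSq (fun y => (f y : ℂ) * g y) x
      ≤ ENNReal.ofReal (2 * n * C ^ 2) * ‖g x‖ₑ ^ 2 + 2 * gradSq g x := by
  rw [gradSq_eq_ofReal, gradSq_eq_ofReal, enorm_sq_eq_ofReal, ← ENNReal.ofReal_ofNat 2,
    ← ENNReal.ofReal_mul (by positivity), ← ENNReal.ofReal_mul (by positivity),
    ← ENNReal.ofReal_add (by positivity) (by positivity)]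
  refine ENNReal.ofReal_le_ofReal ?_
  have h1 : ∀ j : Fin n, ‖partialDeriv (fun y => (f y : ℂ) * g y) j x‖ ^ 2
      ≤ 2 * C ^ 2 * ‖g x‖ ^ 2 + 2 * ‖partialDeriv g j x‖ ^ 2 := by
    intro j
    rw [partialDeriv_real_mul hfd hgd]
    have e1 : ‖(fderiv ℝ f x (EuclideanSpace.single j 1) : ℂ)‖ ≤ C := by
      rw [Complex.norm_real]
      refine (ContinuousLinearMap.le_opNorm _ _).trans ?_
      simpa using norm_fderiv_le_of_lipschitz ℝ hf
    have e2 : ‖(fderiv ℝ f x (EuclideanSpace.single j 1) : ℂ) * g x + f x * partialDeriv g j x‖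
        ≤ C * ‖g x‖ + 1 * ‖partialDeriv g j x‖ := by
      refine (norm_add_le _ _).trans ?_
      rw [norm_mul, norm_mul, Complex.norm_real (f x)]
      gcongr
      exact hf1
    calc _ ≤ (C * ‖g x‖ + 1 * ‖partialDeriv g j x‖) ^ 2 := by gcongr
      _ ≤ _ := by nlinarith [sq_nonneg (C * ‖g x‖ - ‖partialDeriv g j x‖)]
  refine (Finset.sum_le_sum fun j _ => h1 j).trans (le_of_eq ?_)
  rw [Finset.sum_add_distrib, ← Finset.mul_sum _ (fun j => ‖partialDeriv g j x‖ ^ 2), Finset.sum_const, Finset.card_univ,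
    Fintype.card_fin, nsmul_eq_mul]
  ring

theorem gradSq_const_sub (c : ℂ) (w : Space n → ℂ) (x : Space n) :
    gradSq (fun y => c - w y) x = gradSq w x := by
  simp [gradSq, partialDeriv, fderiv_const_sub]

/-- The mean over `Q_{2d}` of a function which vanishes on `F ⊆ Q_d` is controlled by the energy
and the capacity of `F`. -/
theorem enorm_average_sq_mul_cubeCapacity_le {w : Space n → ℂ} {C : NNReal}
    (hw : LipschitzWith C w) {B : NNReal} (hB : ∀ y, ‖w y‖ ≤ B) {x : Space n} {d : ℝ}
    (hd : 0 < d) {F : Set (Space n)} (hF : F ⊆ closedCube x d) (h0 : ∀ y ∈ F, w y = 0) :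
    ‖⨍ y in openCube x (2 * d), w y‖ₑ ^ 2 * cubeCapacity x d F
      ≤ ENNReal.ofReal (2 ^ n * 128 * n ^ 2 + 2) * ∫⁻ y in openCube x (2 * d), gradSq w y := by
  set m := ⨍ y in openCube x (2 * d), w y with hm
  set η := cutoff (closedCube x d) (d / 4) with hη
  have hd4 : 0 < d / 4 := by positivity
  have hηl := lipschitzWith_cutoff (closedCube x d) hd4.le
  have hη1 : ∀ y, |η y| ≤ 1 := fun y =>
    abs_le.2 ⟨by linarith [cutoff_nonneg (closedCube x d) (d / 4) y],
      cutoff_le_one _ hd4.le y⟩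
  have hgl : LipschitzWith C (fun y => m - w y) := by
    refine LipschitzWith.of_dist_le_mul fun y z => ?_
    rw [dist_sub_left]
    exact hw.dist_le_mul y z
  have hne : (closedCube x d).Nonempty := ⟨x, fun j => by simpa using (half_pos hd).le⟩
  -- This function equals `m` on `F` and is supported in `Q_{2d}`. The cutoff costs `|w - m|² / d²`,
  -- and Poincaré's inequality on `Q_{2d}` turns this into gradient energy.
  set v : Space n → ℂ := fun y => (η y : ℂ) * (m - w y) with hv
  have hvl : LipschitzWith _ v := lipschitzWith_mul_of_bounded hηl hgl (Bf := 1)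
    (Bg := ‖m‖₊ + B) (fun y => by simpa using hη1 y) (fun y => by
      refine (norm_sub_le _ _).trans ?_
      push_cast
      gcongr
      exact hB y)
  have hvs : tsupport v ⊆ Metric.cthickening (d / 4) (closedCube x d) := by
    refine closure_minimal (fun y hy => ?_) Metric.isClosed_cthickening
    refine mem_cthickening_of_cutoff_ne_zero hne hd4 fun h => hy ?_
    simp [hv, hη, h]
  have hvs2 : tsupport v ⊆ openCube x (2 * d) := hvs.trans (cthickening_closedCube_subset x hd)
  have hvc : HasCompactSupport v :=
    (isCompact_closedCube x d).cthickening.of_isClosed_subset (isClosed_tsupport v) hvs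
  have hcap : ‖m‖ₑ ^ 2 * cubeCapacity x d F ≤ ∫⁻ y, gradSq v y := by
    refine enorm_sq_mul_wienerCapacity_le hvl hvc ?_ fun y hy => ?_
    · split_ifs
      · exact hvs2
      · exact subset_univ _
    · simp [hv, hη, cutoff_eq_one (hF hy), h0 y hy]
  -- Multiplied by the Poincaré constant `2ⁿ n (2d)²` of `Q_{2d}`, this yields the final `2ⁿ · 128
  -- n²`.
  have hK : 2 * (n : ℝ) * (Real.toNNReal (d / 4)⁻¹ : ℝ) ^ 2 = 32 * n / d ^ 2 := by
    rw [Real.coe_toNNReal _ (by positivity)]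
    field_simp
    ring
  have hle : ∀ᵐ y, gradSq v y ≤ (openCube x (2 * d)).indicator
      (fun y => ENNReal.ofReal (32 * n / d ^ 2) * ‖w y - m‖ₑ ^ 2 + 2 * gradSq w y) y := by
    filter_upwards [hηl.ae_differentiableAt, hgl.ae_differentiableAt] with y h1 h2
    by_cases hy : y ∈ openCube x (2 * d)
    · rw [indicator_of_mem hy]
      have := gradSq_real_mul_le hηl h1 h2 (hη1 y)
      rw [hK, gradSq_const_sub, ← enorm_neg, neg_sub] at this
      exact this
    · rw [indicator_of_notMem hy]
      have hz : v =ᶠ[𝓝 y] 0 := notMem_tsupport_iff_eventuallyEq.1 fun h => hy (hvs2 h)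
      have : fderiv ℝ v y = 0 := by
        rw [hz.fderiv_eq]
        simp
      simp [gradSq, partialDeriv, this]
  have hwc := hw.continuous
  calc _ ≤ _ := hcap
    _ ≤ ∫⁻ y in openCube x (2 * d),
        (ENNReal.ofReal (32 * n / d ^ 2) * ‖w y - m‖ₑ ^ 2 + 2 * gradSq w y) := by
        rw [← lintegral_indicator (isOpen_openCube _ _).measurableSet]
        exact lintegral_mono_ae hle
    _ = ENNReal.ofReal (32 * n / d ^ 2) * (∫⁻ y in openCube x (2 * d), ‖w y - m‖ₑ ^ 2)
        + 2 * ∫⁻ y in openCube x (2 * d), gradSq w y := by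
        rw [lintegral_add_right _ ((measurable_gradSq w).const_mul 2),
          lintegral_const_mul _ (by fun_prop), lintegral_const_mul _ (measurable_gradSq w)]
    _ ≤ ENNReal.ofReal (32 * n / d ^ 2) * (ENNReal.ofReal (2 ^ n * (n * (2 * d) ^ 2))
          * ∫⁻ y in openCube x (2 * d), gradSq w y)
        + 2 * ∫⁻ y in openCube x (2 * d), gradSq w y := by
        gcongr
        exact openCube_lintegral_sub_average_sq_le hw x (by positivity)
    _ = _ := by
        generalize ∫⁻ y in openCube x (2 * d), gradSq w y = I
        have h2 : (2 : ℝ≥0∞) = ENNReal.ofReal 2 := by simp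
        rw [← mul_assoc, ← ENNReal.ofReal_mul (by positivity), h2, ← add_mul,
          ← ENNReal.ofReal_add (by positivity) (by norm_num)]
        congr 3
        field_simp
        ring

/-- Maz'ya's inequality: Poincaré's inequality for functions vanishing on a set of large
capacity. -/
theorem exists_lintegral_sq_le_of_cubeCapacity (hn : 2 ≤ n) {c : ℝ} (hc : 0 < c) :
    ∃ A : ℝ, 0 < A ∧ ∀ (w : Space n → ℂ) (C B : NNReal), LipschitzWith C w → (∀ y, ‖w y‖ ≤ B) →
      ∀ (x : Space n) (d : ℝ), 0 < d → ∀ F ⊆ closedCube x d, (∀ y ∈ F, w y = 0) →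
      ENNReal.ofReal c * cubeCapacity x d (closedCube x d) < cubeCapacity x d F →
      ∫⁻ y in openCube x d, ‖w y‖ₑ ^ 2
        ≤ ENNReal.ofReal (A * d ^ 2) * ∫⁻ y in openCube x (2 * d), gradSq w y := by
  obtain ⟨κ, hκ, hcap⟩ := exists_le_cubeCapacity_closedCube hn
  set A₁ : ℝ := 2 ^ n * 128 * n ^ 2 + 2 with hA₁
  refine ⟨2 * (2 ^ n * (n * 4)) + 2 * (A₁ / (c * κ)), by positivity,
    fun w C B hw hB x d hd F hF h0 hlt => ?_⟩
  set m := ⨍ y in openCube x (2 * d), w y with hm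
  set I := ∫⁻ y in openCube x (2 * d), gradSq w y with hI
  -- Since `cap F > c cap Q_d ≥ c κ d^(n-2)`, the bound on `|m|² cap F` becomes one on `|m|² dⁿ`,
  -- with exactly the factor `d²` of the Poincaré term.
  have h1 : ENNReal.ofReal (d ^ n) * ‖m‖ₑ ^ 2 ≤ ENNReal.ofReal (A₁ / (c * κ) * d ^ 2) * I := by
    have e1 : ‖m‖ₑ ^ 2 * ENNReal.ofReal (c * (κ * d ^ (n - 2))) ≤ ENNReal.ofReal A₁ * I := by
      refine le_trans ?_ (enorm_average_sq_mul_cubeCapacity_le hw hB hd hF h0)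
      gcongr
      refine le_trans ?_ hlt.le
      rw [ENNReal.ofReal_mul hc.le]
      gcongr
      exact hcap x d hd
    have e2 : d ^ n = d ^ 2 / (c * κ) * (c * (κ * d ^ (n - 2))) := by
      have : d ^ n = d ^ 2 * d ^ (n - 2) := by rw [← pow_add, Nat.add_sub_cancel' hn]
      rw [this]
      field_simp
    rw [e2, ENNReal.ofReal_mul (by positivity)]
    calc _ = ENNReal.ofReal (d ^ 2 / (c * κ))
          * (‖m‖ₑ ^ 2 * ENNReal.ofReal (c * (κ * d ^ (n - 2)))) := by ring
      _ ≤ ENNReal.ofReal (d ^ 2 / (c * κ)) * (ENNReal.ofReal A₁ * I) := by gcongr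
      _ = _ := by
        rw [← mul_assoc, ← ENNReal.ofReal_mul (by positivity)]
        congr 2
        ring
  have hwc := hw.continuous
  calc _ ≤ ∫⁻ y in openCube x d, (2 * ‖w y - m‖ₑ ^ 2 + 2 * ‖m‖ₑ ^ 2) :=
        lintegral_mono fun y => enorm_sq_le_two_mul _ _
    _ = 2 * (∫⁻ y in openCube x d, ‖w y - m‖ₑ ^ 2)
        + 2 * (ENNReal.ofReal (d ^ n) * ‖m‖ₑ ^ 2) := by
        rw [lintegral_add_right _ measurable_const, lintegral_const_mul _ (by fun_prop),
          setLIntegral_const, volume_openCube x hd.le]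
        ring
    _ ≤ 2 * (ENNReal.ofReal (2 ^ n * (n * (2 * d) ^ 2)) * I)
        + 2 * (ENNReal.ofReal (A₁ / (c * κ) * d ^ 2) * I) := by
        gcongr
        exact (lintegral_mono_set (openCube_mono x (by linarith))).trans
          (openCube_lintegral_sub_average_sq_le hw x (by positivity))
    _ = _ := by
        have h2 : (2 : ℝ≥0∞) = ENNReal.ofReal 2 := by simp
        rw [h2, ← mul_assoc (ENNReal.ofReal 2), ← mul_assoc (ENNReal.ofReal 2),
          ← ENNReal.ofReal_mul zero_le_two, ← ENNReal.ofReal_mul zero_le_two, ← add_mul,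
          ← ENNReal.ofReal_add (by positivity) (by positivity)]
        congr 2
        ring

end Mazya

/-! ### The diamagnetic inequality and the estimate on a single cube. -/

section CubeEstimate

variable {n : ℕ}

/-- The diamagnetic inequality, for functions which are `1`-Lipschitz functions of `|φ|`. -/
theorem norm_partialDeriv_le_norm_magneticPartial (a : Space n → Space n) {φ w : Space n → ℂ}
    {x : Space n} (hφ : DifferentiableAt ℝ φ x)
    (hw : ∀ y z, ‖w y - w z‖ ≤ |‖φ y‖ - ‖φ z‖|) (j : Fin n) :
    ‖partialDeriv w j x‖ ≤ ‖magneticPartial a φ j x‖ := by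
  by_cases hwd : DifferentiableAt ℝ w x
  swap
  -- Where `w` is not differentiable, `fderiv` has the default value `0`.
  · simp [partialDeriv, fderiv_zero_of_not_differentiableAt hwd]
  have hline : HasDerivAt (fun t : ℝ => x + t • EuclideanSpace.single j (1 : ℝ))
      (EuclideanSpace.single j (1 : ℝ)) 0 := by
    simpa using ((hasDerivAt_id (0 : ℝ)).smul_const (EuclideanSpace.single j (1 : ℝ))).const_add x
  have hw1 : HasDerivAt (fun t : ℝ => w (x + t • EuclideanSpace.single j (1 : ℝ)))
      (partialDeriv w j x) 0 := by
    have h : HasFDerivAt w (fderiv ℝ w x) (x + (0 : ℝ) • EuclideanSpace.single j (1 : ℝ)) := by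
      simpa using hwd.hasFDerivAt
    exact h.comp_hasDerivAt 0 hline
  have hφ1 : HasDerivAt (fun t : ℝ => φ (x + t • EuclideanSpace.single j (1 : ℝ)))
      (partialDeriv φ j x) 0 := by
    have h : HasFDerivAt φ (fderiv ℝ φ x) (x + (0 : ℝ) • EuclideanSpace.single j (1 : ℝ)) := by
      simpa using hφ.hasFDerivAt
    exact h.comp_hasDerivAt 0 hline
  -- Gauge factor with `a` frozen at `x`: along the line it leaves `|φ|` unchanged, and it turns the
  -- derivative at `0` into the magnetic one. Only the value of `a` at `x` enters, so no regularity
  -- of `a` is needed; the difference quotients of `w` are dominated by those of the gauged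
  -- function.
  have he : HasDerivAt (fun t : ℝ => Complex.exp (((a x j * t : ℝ) : ℂ) * Complex.I))
      ((a x j : ℂ) * Complex.I) 0 := by
    have h1 : HasDerivAt (fun t : ℝ => ((a x j * t : ℝ) : ℂ) * Complex.I)
        ((a x j : ℂ) * Complex.I) 0 := by
      have := ((hasDerivAt_id (0 : ℝ)).const_mul (a x j)).ofReal_comp.mul_const Complex.I
      simpa using this
    simpa using h1.cexp
  have hg := he.mul hφ1
  set g : ℝ → ℂ := (fun t : ℝ => Complex.exp (((a x j * t : ℝ) : ℂ) * Complex.I))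
    * fun t : ℝ => φ (x + t • EuclideanSpace.single j (1 : ℝ)) with hgdef
  have hgn : ∀ t, ‖g t‖ = ‖φ (x + t • EuclideanSpace.single j (1 : ℝ))‖ := fun t => by
    rw [hgdef, Pi.mul_apply, norm_mul, Complex.norm_exp_ofReal_mul_I, one_mul]
  have hval : (a x j : ℂ) * Complex.I * φ (x + (0 : ℝ) • EuclideanSpace.single j (1 : ℝ))
      + Complex.exp (((a x j * 0 : ℝ) : ℂ) * Complex.I) * partialDeriv φ j x
      = magneticPartial a φ j x := by
    simp [magneticPartial]
    ring
  rw [hval] at hg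
  refine le_of_tendsto_of_tendsto' (hasDerivAt_iff_tendsto_slope_zero.1 hw1).norm
    (hasDerivAt_iff_tendsto_slope_zero.1 hg).norm fun t => ?_
  rw [norm_smul, norm_smul]
  gcongr
  refine (hw _ _).trans ?_
  rw [← hgn, ← hgn]
  exact abs_norm_sub_norm_le _ _

/-- The truncation `(|φ| - τ)₊`. -/
def truncation (φ : Space n → ℂ) (τ : ℝ) (y : Space n) : ℂ := ((max 0 (‖φ y‖ - τ) : ℝ) : ℂ)

theorem norm_truncation_sub_le (φ : Space n → ℂ) (τ : ℝ) (y z : Space n) :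
    ‖truncation φ τ y - truncation φ τ z‖ ≤ |‖φ y‖ - ‖φ z‖| := by
  rw [truncation, truncation, ← Complex.ofReal_sub, Complex.norm_real, Real.norm_eq_abs]
  refine (abs_max_sub_max_le_max _ _ _ _).trans ?_
  simp

theorem norm_truncation (φ : Space n → ℂ) (τ : ℝ) (y : Space n) :
    ‖truncation φ τ y‖ = max 0 (‖φ y‖ - τ) := by
  rw [truncation, Complex.norm_real, Real.norm_of_nonneg (le_max_left _ _)]

theorem lipschitzWith_truncation {φ : Space n → ℂ} {C : NNReal} (hφ : LipschitzWith C φ) (τ : ℝ) :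
    LipschitzWith C (truncation φ τ) := by
  refine LipschitzWith.of_dist_le_mul fun y z => ?_
  rw [dist_eq_norm]
  refine (norm_truncation_sub_le φ τ y z).trans ((abs_norm_sub_norm_le _ _).trans ?_)
  rw [← dist_eq_norm]
  exact hφ.dist_le_mul y z

/-- The energy density `|∇_a u|² + V |u|²`. -/
def energyDensity (a : Space n → Space n) (V : Space n → ℝ) (u : Space n → ℂ) (x : Space n) :
    ℝ≥0∞ :=
  (∑ j, ‖magneticPartial a u j x‖ₑ ^ 2) + ENNReal.ofReal (V x) * ‖u x‖ₑ ^ 2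

theorem gradSq_truncation_le (a : Space n → Space n) (V : Space n → ℝ) {φ : Space n → ℂ}
    (hφ : Differentiable ℝ φ) (τ : ℝ) (x : Space n) :
    gradSq (truncation φ τ) x ≤ energyDensity a V φ x := by
  refine le_trans (Finset.sum_le_sum fun j _ => ?_) le_self_add
  gcongr
  rw [← ofReal_norm, ← ofReal_norm]
  exact ENNReal.ofReal_le_ofReal (norm_partialDeriv_le_norm_magneticPartial a (hφ x)
    (norm_truncation_sub_le φ τ) j)

theorem exists_lipschitzWith_test (φ : testFunctions n) :
    ∃ C, LipschitzWith C (φ : Space n → ℂ) :=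
  φ.2.1.lipschitzWith_of_hasCompactSupport φ.2.2 (by simp)

theorem exists_bound_test (φ : testFunctions n) : ∃ B : NNReal, ∀ y, ‖(φ : Space n → ℂ) y‖ ≤ B := by
  obtain ⟨B, hB⟩ := φ.2.2.exists_bound_of_continuous φ.2.1.continuous
  exact ⟨B.toNNReal, fun y => (hB y).trans (Real.le_coe_toNNReal B)⟩

theorem localEnergy_mul_le (a : Space n → Space n) (V : Space n → ℝ) (φ : testFunctions n)
    (x : Space n) (d : ℝ) :
    localEnergy a x d * (∫⁻ y in openCube x d, ‖(φ : Space n → ℂ) y‖ₑ ^ 2)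
      ≤ ∫⁻ y in openCube x d, energyDensity a V φ y := by
  by_cases h0 : ∃ y ∈ openCube x d, (φ : Space n → ℂ) y ≠ 0
  · have h1 : localEnergy a x d ≤ (∫⁻ y in openCube x d, energyDensity a (fun _ => 0) φ y)
        / ∫⁻ y in openCube x d, ‖(φ : Space n → ℂ) y‖ₑ ^ 2 :=
      iInf_le_of_le (φ : Space n → ℂ) (iInf_le_of_le φ.2.1.contDiffOn
        (iInf_le_of_le ((memLp_test φ).restrict _) (iInf_le_of_le h0 le_rfl)))
    refine le_trans (ENNReal.mul_le_of_le_div h1) (lintegral_mono fun y => ?_)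
    simp [energyDensity]
  · push Not at h0
    have : ∫⁻ y in openCube x d, ‖(φ : Space n → ℂ) y‖ₑ ^ 2 = 0 := by
      rw [setLIntegral_congr_fun (isOpen_openCube x d).measurableSet
        (g := fun _ => 0) fun y hy => by simp [h0 y hy]]
      simp
    simp [this]

theorem lintegral_openCube_test_ne_top (φ : testFunctions n) (x : Space n) (d : ℝ) :
    ∫⁻ y in openCube x d, ‖(φ : Space n → ℂ) y‖ₑ ^ 2 ≠ ⊤ := by
  have h := (memLp_test φ).restrict (openCube x d)
  have := h.eLpNorm_ne_top
  rw [eLpNorm_eq_lintegral_rpow_enorm_toReal (by norm_num) (by norm_num)] at this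
  intro hc
  simp [hc] at this

/-- The sublevel set of `|φ|` is an admissible `F` in the Molchanov functional, and off it `V |φ|² ≥
τ² V`. -/
theorem sq_mul_molchanov_le {c : ℝ} {x : Space n} {d : ℝ} (hd : 0 < d) (a : Space n → Space n)
    {V : Space n → ℝ} {φ : Space n → ℂ} (hφ : Continuous φ) {τ : ℝ} (hτ : 0 ≤ τ)
    (hcap : cubeCapacity x d {y ∈ closedCube x d | ‖φ y‖ ≤ τ}
      ≤ ENNReal.ofReal c * cubeCapacity x d (closedCube x d)) :
    ENNReal.ofReal (τ ^ 2) * molchanov c x d V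
      ≤ ∫⁻ y in openCube x (2 * d), energyDensity a V φ y := by
  set F := {y ∈ closedCube x d | ‖φ y‖ ≤ τ} with hF
  have hFcl : IsClosed {y | ‖φ y‖ ≤ τ} := isClosed_le hφ.norm continuous_const
  have hFc : IsCompact F := (isCompact_closedCube x d).inter_right hFcl
  have hM : molchanov c x d V ≤ ∫⁻ y in closedCube x d \ F, ENNReal.ofReal (V y) :=
    iInf_le_of_le F (iInf_le_of_le hFc (iInf_le_of_le (fun y hy => hy.1)
      (iInf_le_of_le hcap le_rfl)))
  calc _ ≤ ENNReal.ofReal (τ ^ 2) * ∫⁻ y in closedCube x d \ F, ENNReal.ofReal (V y) := by gcongr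
    _ = ∫⁻ y in closedCube x d \ F, ENNReal.ofReal (τ ^ 2) * ENNReal.ofReal (V y) :=
        (lintegral_const_mul' _ _ ENNReal.ofReal_ne_top).symm
    _ ≤ ∫⁻ y in closedCube x d \ F, energyDensity a V φ y := by
        refine setLIntegral_mono' ((isClosed_closedCube x d).measurableSet.diff
          hFc.isClosed.measurableSet) fun y hy => ?_
        refine le_trans ?_ le_add_self
        rw [mul_comm, enorm_sq_eq_ofReal]
        gcongr
        by_contra! h
        exact hy.2 ⟨hy.1, h.le⟩
    _ ≤ _ := lintegral_mono_set (sdiff_subset.trans (closedCube_subset_openCube x (by linarith)))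

/-- The estimate on a single cube. -/
theorem exists_lintegral_openCube_le (hn : 2 ≤ n) {c : ℝ} (hc : 0 < c) :
    ∃ A : ℝ, 0 < A ∧ ∀ (a : Space n → Space n) (V : Space n → ℝ) (φ : testFunctions n)
      (x : Space n) (d : ℝ), 0 < d → ∀ N : ℝ, 0 < N →
      ENNReal.ofReal N ≤ localEnergy a x d
        + (ENNReal.ofReal (d ^ n))⁻¹ * molchanov c x d V →
      ∫⁻ y in openCube x d, ‖(φ : Space n → ℂ) y‖ₑ ^ 2
        ≤ ENNReal.ofReal (A * d ^ 2 + 8 / N)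
          * ∫⁻ y in openCube x (2 * d), energyDensity a V φ y := by
  obtain ⟨A, hA, hmaz⟩ := exists_lintegral_sq_le_of_cubeCapacity hn hc
  refine ⟨4 * A, by positivity, fun a V φ x d hd N hN hle => ?_⟩
  set G := ∫⁻ y in openCube x (2 * d), energyDensity a V φ y with hG
  set S := ∫⁻ y in openCube x d, ‖(φ : Space n → ℂ) y‖ₑ ^ 2 with hS
  have hStop : S ≠ ⊤ := lintegral_openCube_test_ne_top φ x d
  have hdn : 0 < d ^ n := pow_pos hd n
  have hsplit : ENNReal.ofReal (N / 2) ≤ localEnergy a x d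
      ∨ ENNReal.ofReal (N / 2) ≤ (ENNReal.ofReal (d ^ n))⁻¹ * molchanov c x d V := by
    by_contra! h
    have := ENNReal.add_lt_add h.1 h.2
    rw [← ENNReal.ofReal_add (by positivity) (by positivity), add_halves] at this
    exact absurd hle this.not_ge
  have hfinish : ENNReal.ofReal (N / 8) * S ≤ G →
      S ≤ ENNReal.ofReal (4 * A * d ^ 2 + 8 / N) * G := by
    intro h
    calc S = ENNReal.ofReal (8 / N) * (ENNReal.ofReal (N / 8) * S) := by
          rw [← mul_assoc, ← ENNReal.ofReal_mul (by positivity)]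
          have : 8 / N * (N / 8) = 1 := by field_simp
          rw [this, ENNReal.ofReal_one, one_mul]
      _ ≤ ENNReal.ofReal (4 * A * d ^ 2 + 8 / N) * G := by
          gcongr
          linarith [show 0 < 4 * A * d ^ 2 by positivity]
  rcases hsplit with h | h
  · apply hfinish
    calc _ ≤ localEnergy a x d * S := by
          gcongr
          refine le_trans (ENNReal.ofReal_le_ofReal (by linarith)) h
      _ ≤ ∫⁻ y in openCube x d, energyDensity a V φ y := localEnergy_mul_le a V φ x d
      _ ≤ G := lintegral_mono_set (openCube_mono x (by linarith))
  · set s := S.toReal with hs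
    have hSs : S = ENNReal.ofReal s := (ENNReal.ofReal_toReal hStop).symm
    have hs0 : 0 ≤ s := ENNReal.toReal_nonneg
    -- With this level `τ² |Q_d| = S / 4`. So `2 τ² |Q_d| = S / 2` can be absorbed in the case of
    -- large capacity, and `τ² dⁿ · N / 2 = (N / 8) S` in the case of small capacity.
    set τ := √(s / (4 * d ^ n)) with hτ
    have hτ2 : τ ^ 2 = s / (4 * d ^ n) := Real.sq_sqrt (by positivity)
    have hτ0 : 0 ≤ τ := Real.sqrt_nonneg _
    by_cases hcap : cubeCapacity x d {y ∈ closedCube x d | ‖(φ : Space n → ℂ) y‖ ≤ τ}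
        ≤ ENNReal.ofReal c * cubeCapacity x d (closedCube x d)
    · apply hfinish
      have h1 := sq_mul_molchanov_le hd a (V := V) φ.2.1.continuous hτ0 hcap
      refine le_trans ?_ h1
      have h2 : ENNReal.ofReal (d ^ n) * ENNReal.ofReal (N / 2) ≤ molchanov c x d V := by
        calc _ ≤ ENNReal.ofReal (d ^ n) * ((ENNReal.ofReal (d ^ n))⁻¹ * molchanov c x d V) := by
              gcongr
          _ = _ := by
              rw [← mul_assoc, ENNReal.mul_inv_cancel (by simpa using hdn) ENNReal.ofReal_ne_top,
                one_mul]
      calc ENNReal.ofReal (N / 8) * S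
          = ENNReal.ofReal (τ ^ 2) * (ENNReal.ofReal (d ^ n) * ENNReal.ofReal (N / 2)) := by
            rw [hSs, ← ENNReal.ofReal_mul (by positivity), ← ENNReal.ofReal_mul (by positivity),
              ← ENNReal.ofReal_mul (by positivity), hτ2]
            congr 1
            field_simp
            ring
        _ ≤ _ := by gcongr
    · obtain ⟨C, hC⟩ := exists_lipschitzWith_test φ
      obtain ⟨B, hB⟩ := exists_bound_test φ
      have h1 := hmaz (truncation φ τ) C B (lipschitzWith_truncation hC τ) (fun y => by
          rw [norm_truncation]
          exact max_le B.2 (by linarith [hB y])) x d hd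
          {y ∈ closedCube x d | ‖(φ : Space n → ℂ) y‖ ≤ τ} (fun y hy => hy.1) (fun y hy => by
            rw [truncation, max_eq_left (by linarith [hy.2]), Complex.ofReal_zero])
          (not_le.1 hcap)
      have h2 : ∫⁻ y in openCube x d, ‖truncation φ τ y‖ₑ ^ 2 ≤ ENNReal.ofReal (A * d ^ 2) * G := by
        refine h1.trans ?_
        gcongr
        exact lintegral_mono fun y =>
          gradSq_truncation_le a V (φ.2.1.differentiable (by simp)) τ y
      have hpt : ∀ y, ‖(φ : Space n → ℂ) y‖ₑ ^ 2
          ≤ 2 * ‖truncation φ τ y‖ₑ ^ 2 + ENNReal.ofReal (2 * τ ^ 2) := by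
        intro y
        rw [enorm_sq_eq_ofReal, enorm_sq_eq_ofReal, norm_truncation, ← ENNReal.ofReal_ofNat 2,
          ← ENNReal.ofReal_mul (by norm_num), ← ENNReal.ofReal_add (by positivity) (by positivity)]
        refine ENNReal.ofReal_le_ofReal ?_
        have e1 : ‖(φ : Space n → ℂ) y‖ ≤ max 0 (‖(φ : Space n → ℂ) y‖ - τ) + τ := by
          linarith [le_max_right 0 (‖(φ : Space n → ℂ) y‖ - τ)]
        have e2 := norm_nonneg ((φ : Space n → ℂ) y)
        nlinarith [sq_nonneg (max 0 (‖(φ : Space n → ℂ) y‖ - τ) - τ)]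
      have h3 : S ≤ 2 * (ENNReal.ofReal (A * d ^ 2) * G) + ENNReal.ofReal (s / 2) := by
        calc S ≤ ∫⁻ y in openCube x d, (2 * ‖truncation φ τ y‖ₑ ^ 2
              + ENNReal.ofReal (2 * τ ^ 2)) := lintegral_mono hpt
          _ = 2 * (∫⁻ y in openCube x d, ‖truncation φ τ y‖ₑ ^ 2)
              + ENNReal.ofReal (2 * τ ^ 2) * ENNReal.ofReal (d ^ n) := by
              rw [lintegral_add_right _ measurable_const, lintegral_const_mul' _ _ (by simp),
                setLIntegral_const, volume_openCube x hd.le]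
          _ ≤ _ := by
              gcongr
              rw [← ENNReal.ofReal_mul (by positivity), hτ2]
              refine ENNReal.ofReal_le_ofReal (le_of_eq ?_)
              field_simp
              ring
      -- The term `S / 2` is absorbed into the left side, which is legitimate because `S` is finite.
      have h4 : ENNReal.ofReal (s / 2) ≤ 2 * (ENNReal.ofReal (A * d ^ 2) * G) := by
        have : S = ENNReal.ofReal (s / 2) + ENNReal.ofReal (s / 2) := by
          rw [hSs, ← ENNReal.ofReal_add (by positivity) (by positivity), add_halves]
        rw [this] at h3
        exact (ENNReal.add_le_add_iff_right ENNReal.ofReal_ne_top).1 h3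
      calc S = 2 * ENNReal.ofReal (s / 2) := by
            rw [hSs, ← ENNReal.ofReal_ofNat 2, ← ENNReal.ofReal_mul (by norm_num)]
            congr 1
            ring
        _ ≤ 2 * (2 * (ENNReal.ofReal (A * d ^ 2) * G)) := by gcongr
        _ = ENNReal.ofReal (4 * A * d ^ 2) * G := by
            rw [← mul_assoc, ← mul_assoc, mul_assoc 4 A,
              ENNReal.ofReal_mul (show (0 : ℝ) ≤ 4 by norm_num)]
            norm_num
        _ ≤ _ := by
            gcongr
            linarith [show 0 < 8 / N by positivity]

end CubeEstimate

/-! ### Smallness of the mass at infinity. -/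

section Global

variable {n : ℕ} {a : Space n → Space n} {V : Space n → ℝ}

theorem ofReal_norm_toLp_sq {f : Space n → ℂ} (hf : MemLp f 2 volume) :
    ENNReal.ofReal (‖hf.toLp‖ ^ 2) = ∫⁻ x, ‖f x‖ₑ ^ 2 := by
  rw [Lp.norm_toLp, ENNReal.ofReal_pow ENNReal.toReal_nonneg,
    ENNReal.ofReal_toReal hf.eLpNorm_ne_top,
    eLpNorm_eq_lintegral_rpow_enorm_toReal (by norm_num) (by norm_num), ← ENNReal.rpow_natCast,
    ← ENNReal.rpow_mul]
  norm_num

theorem ofReal_norm_toL2_sq (φ : testFunctions n) :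
    ENNReal.ofReal (‖toL2 n φ‖ ^ 2) = ∫⁻ x, ‖(φ : Space n → ℂ) x‖ₑ ^ 2 :=
  ofReal_norm_toLp_sq (memLp_test φ)

theorem ofReal_sum_norm_componentL2_sq (ha : VecLocMemLp 2 a) (hV : LocallyIntegrable V volume)
    (hV0 : ∀ᵐ x, 0 ≤ V x) (φ : testFunctions n) :
    ENNReal.ofReal (∑ o, ‖componentL2 ha hV hV0 o φ‖ ^ 2) = ∫⁻ x, energyDensity a V φ x := by
  rw [ENNReal.ofReal_sum_of_nonneg fun _ _ => by positivity]
  have h1 : ∀ o, ENNReal.ofReal (‖componentL2 ha hV hV0 o φ‖ ^ 2)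
      = ∫⁻ x, ‖component a V o (φ : Space n → ℂ) x‖ₑ ^ 2 := fun o =>
    ofReal_norm_toLp_sq (memLp_component ha hV hV0 o φ)
  simp_rw [h1]
  rw [← lintegral_finsetSum' _ fun o _ =>
    (memLp_component ha hV hV0 o φ).1.enorm.pow_const 2]
  refine lintegral_congr_ae ?_
  filter_upwards [hV0] with x hx
  rw [Fintype.sum_option, add_comm, energyDensity]
  congr 1
  simp only [component, enorm_mul, mul_pow]
  congr 1
  rw [enorm_sq_eq_ofReal, Complex.norm_real, Real.norm_of_nonneg (Real.sqrt_nonneg _),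
    Real.sq_sqrt hx]

theorem aemeasurable_energyDensity (ha : VecLocMemLp 2 a) (hV : LocallyIntegrable V volume)
    (φ : testFunctions n) : AEMeasurable (energyDensity a V φ) := by
  refine AEMeasurable.add (Finset.aemeasurable_fun_sum _ fun j _ =>
    (memLp_magneticPartial ha φ j).1.enorm.pow_const 2) ?_
  exact hV.aestronglyMeasurable.aemeasurable.ennreal_ofReal.mul
    ((memLp_test φ).1.enorm.pow_const 2)

/-- Integrating over all centers of cubes of a fixed size. -/
theorem lintegral_lintegral_openCube {f : Space n → ℝ≥0∞} (hf : AEMeasurable f) {d : ℝ}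
    (hd : 0 ≤ d) :
    ∫⁻ x, ∫⁻ y in openCube x d, f y = ENNReal.ofReal (d ^ n) * ∫⁻ y, f y := by
  set E : Set (Space n × Space n) := {p | ∀ j, |p.2 j - p.1 j| < d / 2} with hE
  have hEo : IsOpen E := by
    simp only [hE, ofPred_forall]
    exact isOpen_iInter_of_finite fun j => isOpen_lt (by fun_prop) continuous_const
  have h1 : ∀ x, ∫⁻ y in openCube x d, f y = ∫⁻ y, E.indicator (fun p => f p.2) (x, y) := by
    intro x
    rw [← lintegral_indicator (isOpen_openCube x d).measurableSet]
    rfl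
  have hm : AEMeasurable (E.indicator fun p : Space n × Space n => f p.2)
      (volume.prod volume) := hf.comp_snd.indicator hEo.measurableSet
  simp_rw [h1]
  -- Tonelli's theorem and the symmetry `y ∈ Q_d(x) ↔ x ∈ Q_d(y)`. Averaging over all centers takes
  -- the place of a covering with bounded overlap.
  rw [lintegral_lintegral_swap (f := fun x y => E.indicator (fun p => f p.2) (x, y)) hm,
    ← lintegral_const_mul' _ _ ENNReal.ofReal_ne_top]
  refine lintegral_congr fun y => ?_
  have h2 : (fun x => E.indicator (fun p => f p.2) (x, y))
      = (openCube y d).indicator fun _ => f y := by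
    ext x
    have : (x, y) ∈ E ↔ x ∈ openCube y d := forall_congr' fun j => by rw [abs_sub_comm]
    by_cases hx : x ∈ openCube y d
    · rw [indicator_of_mem hx, indicator_of_mem (this.2 hx)]
    · rw [indicator_of_notMem hx, indicator_of_notMem (mt this.1 hx)]
  rw [h2, lintegral_indicator (isOpen_openCube y d).measurableSet, setLIntegral_const,
    volume_openCube y hd, mul_comm]

/-- Smallness at infinity of functions of bounded energy. -/
theorem exists_lintegral_far_le (hn : 2 ≤ n) (ha : VecLocMemLp 2 a)
    (hV : LocallyIntegrable V volume) {c d₁ : ℝ} (hc : 0 < c) (hd₁ : 0 < d₁)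
    (h : ∀ d : ℝ, 0 < d → d < d₁ →
      Tendsto (fun x : Space n => localEnergy a x d
        + (ENNReal.ofReal (d ^ n))⁻¹ * molchanov c x d V) (cocompact (Space n)) (𝓝 ⊤))
    {ε : ℝ} (hε : 0 < ε) :
    ∃ R : ℝ, ∀ φ : testFunctions n,
      ∫⁻ y in (Metric.closedBall 0 R)ᶜ, ‖(φ : Space n → ℂ) y‖ₑ ^ 2
        ≤ ENNReal.ofReal ε * ∫⁻ y, energyDensity a V φ y := by
  obtain ⟨A, hA, hcube⟩ := exists_lintegral_openCube_le hn hc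
  -- Averaged over centers, the cubes `Q_{2d}` on the right weigh `(2d)ⁿ` against `dⁿ` on the left,
  -- which costs `2ⁿ`.
  set ε' := ε / 2 ^ n with hε'
  have hε'0 : 0 < ε' := by positivity
  obtain ⟨d, hd, hdd₁, hdA⟩ : ∃ d, 0 < d ∧ d < d₁ ∧ A * d ^ 2 ≤ ε' / 2 := by
    have ht : Tendsto (fun d : ℝ => A * d ^ 2) (𝓝[>] 0) (𝓝 0) := by
      have : Tendsto (fun d : ℝ => A * d ^ 2) (𝓝 0) (𝓝 (A * 0 ^ 2)) :=
        (by fun_prop : Continuous fun d : ℝ => A * d ^ 2).tendsto 0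
      simpa using this.mono_left nhdsWithin_le_nhds
    obtain ⟨d, h1, h2, h3⟩ := ((ht.eventually (gt_mem_nhds (half_pos hε'0))).and
      ((eventually_mem_nhdsWithin).and
        (nhdsWithin_le_nhds (gt_mem_nhds hd₁)))).exists
    exact ⟨d, h2, h3, h1.le⟩
  -- The edge `d` is already fixed, with `A d² ≤ ε' / 2`; this `N` makes `8 / N = ε' / 2`.
  set N := 16 / ε' with hN
  have hN0 : 0 < N := by positivity
  have hev := (h d hd hdd₁).eventually (lt_mem_nhds (ENNReal.ofReal_lt_top (r := N)))
  obtain ⟨K, hK, hKsub⟩ := mem_cocompact.1 hev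
  obtain ⟨R, hR⟩ := hK.isBounded.subset_closedBall 0
  -- A cube `Q_d` centered in the exceptional compact set `K` lies in this ball, so only cubes with
  -- good centers contribute.
  refine ⟨R + √n * d, fun φ => ?_⟩
  set f : Space n → ℝ≥0∞ := (Metric.closedBall 0 (R + √n * d))ᶜ.indicator
    fun y => ‖(φ : Space n → ℂ) y‖ₑ ^ 2 with hf
  have hfm : AEMeasurable f := ((memLp_test φ).1.enorm.pow_const 2).indicator
    Metric.isClosed_closedBall.measurableSet.compl
  have hg := aemeasurable_energyDensity ha hV φ
  have hpt : ∀ x, ∫⁻ y in openCube x d, f y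
      ≤ ENNReal.ofReal ε' * ∫⁻ y in openCube x (2 * d), energyDensity a V φ y := by
    intro x
    by_cases hx : x ∈ K
    · have : ∫⁻ y in openCube x d, f y = 0 := by
        rw [setLIntegral_congr_fun (isOpen_openCube x d).measurableSet (g := fun _ => 0)
          fun y hy => ?_, lintegral_zero]
        refine indicator_of_notMem (notMem_compl_iff.2 ?_) _
        rw [mem_closedBall_zero_iff]
        have h1 : ‖x‖ ≤ R := mem_closedBall_zero_iff.1 (hR hx)
        have h2 : ‖y - x‖ ≤ √n * d := norm_le_sqrt_mul hd.le fun j =>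
          (hy j).le.trans (by linarith)
        calc ‖y‖ = ‖x + (y - x)‖ := by rw [add_sub_cancel]
          _ ≤ R + √n * d := (norm_add_le _ _).trans (add_le_add h1 h2)
      rw [this]
      exact zero_le
    · have h1 : ∫⁻ y in openCube x d, f y
          ≤ ∫⁻ y in openCube x d, ‖(φ : Space n → ℂ) y‖ₑ ^ 2 :=
        lintegral_mono fun y => indicator_le_self _ _ y
      refine h1.trans ((hcube a V φ x d hd N hN0 (hKsub hx).le).trans ?_)
      gcongr
      have : 8 / N = ε' / 2 := by rw [hN]; field_simp; norm_num
      linarith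
  have hint := lintegral_mono (μ := volume) hpt
  rw [lintegral_lintegral_openCube hfm hd.le, lintegral_const_mul' _ _ ENNReal.ofReal_ne_top,
    lintegral_lintegral_openCube hg (by positivity), hf,
    lintegral_indicator Metric.isClosed_closedBall.measurableSet.compl] at hint
  have hdn : ENNReal.ofReal (d ^ n) ≠ 0 := by simpa using pow_pos hd n
  refine (ENNReal.mul_le_mul_iff_right hdn ENNReal.ofReal_ne_top).1 (hint.trans (le_of_eq ?_))
  rw [← mul_assoc, ← mul_assoc, ← ENNReal.ofReal_mul (by positivity),
    ← ENNReal.ofReal_mul (by positivity)]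
  congr 2
  rw [hε', mul_pow]
  field_simp

/-! ### Local compactness on a grid of small cubes. -/

/-- The half-open cubes of a grid of mesh `δ`. -/
def gridCube (δ : ℝ) (k : Fin n → ℤ) : Set (Space n) := {y | ∀ j, ⌊y j / δ⌋ = k j}

theorem mem_gridCube_iff {δ : ℝ} (hδ : 0 < δ) {k : Fin n → ℤ} {y : Space n} :
    y ∈ gridCube δ k ↔ ∀ j, δ * k j ≤ y j ∧ y j < δ * (k j + 1) := by
  refine forall_congr' fun j => ?_
  rw [Int.floor_eq_iff, le_div_iff₀ hδ, div_lt_iff₀ hδ, mul_comm δ, mul_comm δ]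

theorem measurableSet_gridCube (δ : ℝ) (k : Fin n → ℤ) : MeasurableSet (gridCube δ k) := by
  simp only [gridCube, ofPred_forall]
  refine MeasurableSet.iInter fun j => ?_
  have : Measurable fun y : Space n => ⌊y j / δ⌋ := Int.measurable_floor.comp (by fun_prop)
  exact this (measurableSet_singleton (k j))

theorem convex_gridCube {δ : ℝ} (hδ : 0 < δ) (k : Fin n → ℤ) : Convex ℝ (gridCube δ k) := by
  have : gridCube δ k = ⋂ j, (fun y : Space n => y j) ⁻¹' Ico (δ * k j) (δ * (k j + 1)) := by
    ext y
    simp [mem_gridCube_iff hδ]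
  rw [this]
  exact convex_iInter fun j => (convex_Ico _ _).is_linear_preimage
    ⟨fun _ _ => rfl, fun _ _ => rfl⟩

theorem gridCube_enorm_sub_le {δ : ℝ} (hδ : 0 < δ) (k : Fin n → ℤ) :
    ∀ y ∈ gridCube δ k, ∀ z ∈ gridCube δ k, ‖z - y‖ₑ ≤ ENNReal.ofReal (√n * δ) := by
  intro y hy z hz
  rw [← ofReal_norm]
  refine ENNReal.ofReal_le_ofReal (norm_le_sqrt_mul hδ.le fun j => ?_)
  have h1 := (mem_gridCube_iff hδ).1 hy j
  have h2 := (mem_gridCube_iff hδ).1 hz j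
  rw [PiLp.sub_apply, abs_le]
  constructor <;> linarith [h1.1, h1.2, h2.1, h2.2]

/-- The center of a cube of the grid. -/
def gridCenter (δ : ℝ) (k : Fin n → ℤ) : Space n := WithLp.toLp 2 fun j => δ * (k j + 1 / 2)

theorem openCube_subset_gridCube {δ : ℝ} (hδ : 0 < δ) (k : Fin n → ℤ) :
    openCube (gridCenter δ k) δ ⊆ gridCube δ k := by
  intro y hy
  refine (mem_gridCube_iff hδ).2 fun j => ?_
  have := abs_lt.1 (hy j)
  simp only [gridCenter] at this
  constructor <;> linarith [this.1, this.2]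

theorem gridCube_subset_closedCube {δ : ℝ} (hδ : 0 < δ) (k : Fin n → ℤ) :
    gridCube δ k ⊆ closedCube (gridCenter δ k) δ := by
  intro y hy j
  have := (mem_gridCube_iff hδ).1 hy j
  simp only [gridCenter]
  rw [abs_le]
  constructor <;> linarith [this.1, this.2]

theorem volume_gridCube_ne_zero {δ : ℝ} (hδ : 0 < δ) (k : Fin n → ℤ) :
    volume (gridCube δ k) ≠ 0 := fun h =>
  volume_openCube_ne_zero (gridCenter δ k) hδ (measure_mono_null (openCube_subset_gridCube hδ k) h)

theorem volume_gridCube_ne_top {δ : ℝ} (hδ : 0 < δ) (k : Fin n → ℤ) :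
    volume (gridCube δ k) ≠ ⊤ :=
  ne_top_of_le_ne_top (isCompact_closedCube (gridCenter δ k) δ).measure_lt_top.ne
    (measure_mono (gridCube_subset_closedCube hδ k))

theorem pairwise_disjoint_gridCube (δ : ℝ) :
    Pairwise fun k l : Fin n → ℤ => Disjoint (gridCube δ k) (gridCube δ l) := by
  intro k l hkl
  rw [Set.disjoint_left]
  intro y hk hl
  exact hkl (funext fun j => (hk j).symm.trans (hl j))

/-- The normalized functional `u ↦ (2 / |T|)^{1/2} ∫_T u` for a cube `T` of the grid. -/
def gridFunctional {δ : ℝ} (hδ : 0 < δ) (k : Fin n → ℤ) : L2 n :=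
  indicatorConstLp 2 (measurableSet_gridCube δ k) (volume_gridCube_ne_top hδ k)
    ((√(2 / volume.real (gridCube δ k)) : ℝ) : ℂ)

/-- The normalization is chosen to give exactly the mean term `2 |T| |m|²` left over by Poincaré's
inequality on the grid cube `T`, where `m` is the mean over `T`. -/
theorem enorm_inner_gridFunctional_sq {δ : ℝ} (hδ : 0 < δ) (k : Fin n → ℤ) (φ : testFunctions n) :
    ‖(inner ℂ (gridFunctional hδ k) (toL2 n φ) : ℂ)‖ₑ ^ 2
      = 2 * (volume (gridCube δ k)
        * ‖⨍ y in gridCube δ k, (φ : Space n → ℂ) y‖ₑ ^ 2) := by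
  set v := volume.real (gridCube δ k) with hv
  have hv0 : 0 < v := ENNReal.toReal_pos (volume_gridCube_ne_zero hδ k) (volume_gridCube_ne_top hδ k)
  have h1 : volume (gridCube δ k) = ENNReal.ofReal v :=
    (ofReal_measureReal (volume_gridCube_ne_top hδ k)).symm
  have h2 : ∫ y in gridCube δ k, toL2 n φ y = ∫ y in gridCube δ k, (φ : Space n → ℂ) y :=
    integral_congr_ae (ae_restrict_of_ae (memLp_test φ).coeFn_toLp)
  rw [gridFunctional, L2.inner_indicatorConstLp_eq_inner_setIntegral, h2, setAverage_eq, h1,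
    enorm_sq_eq_ofReal, enorm_sq_eq_ofReal, ← ENNReal.ofReal_mul hv0.le, ← hv]
  generalize ∫ y in gridCube δ k, (φ : Space n → ℂ) y = z
  have h3 : (2 : ℝ≥0∞) = ENNReal.ofReal 2 := by simp
  rw [h3, ← ENNReal.ofReal_mul zero_le_two]
  congr 1
  rw [RCLike.inner_apply, norm_mul, Complex.conj_ofReal, Complex.norm_real,
    Real.norm_of_nonneg (Real.sqrt_nonneg _), norm_smul, mul_pow, mul_pow,
    Real.sq_sqrt (by positivity), Real.norm_of_nonneg (by positivity)]
  field_simp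

theorem lintegral_gridCube_le {δ : ℝ} (hδ : 0 < δ) (k : Fin n → ℤ) (φ : testFunctions n) :
    ∫⁻ y in gridCube δ k, ‖(φ : Space n → ℂ) y‖ₑ ^ 2
      ≤ ENNReal.ofReal (2 * (2 ^ n * (n * δ ^ 2))) * (∫⁻ y in gridCube δ k, gradSq φ y)
        + ‖(inner ℂ (gridFunctional hδ k) (toL2 n φ) : ℂ)‖ₑ ^ 2 := by
  obtain ⟨C, hC⟩ := exists_lipschitzWith_test φ
  have hφ := φ.2.1.continuous
  set m := ⨍ y in gridCube δ k, (φ : Space n → ℂ) y with hm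
  have h1 := lintegral_sub_average_sq_le hC (convex_gridCube hδ k) (measurableSet_gridCube δ k)
    ((hφ.continuousOn.integrableOn_compact (isCompact_closedCube (gridCenter δ k) δ)).mono_set
      (gridCube_subset_closedCube hδ k)) (volume_gridCube_ne_zero hδ k)
    (volume_gridCube_ne_top hδ k) (gridCube_enorm_sub_le hδ k)
  rw [sqrt_mul_sq_ofReal δ hδ.le] at h1
  calc _ ≤ ∫⁻ y in gridCube δ k, (2 * ‖(φ : Space n → ℂ) y - m‖ₑ ^ 2 + 2 * ‖m‖ₑ ^ 2) :=
        lintegral_mono fun y => enorm_sq_le_two_mul _ _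
    _ = 2 * (∫⁻ y in gridCube δ k, ‖(φ : Space n → ℂ) y - m‖ₑ ^ 2)
        + 2 * (volume (gridCube δ k) * ‖m‖ₑ ^ 2) := by
        rw [lintegral_add_right _ measurable_const, lintegral_const_mul _ (by fun_prop),
          setLIntegral_const]
        ring
    _ ≤ 2 * (2 ^ n * ENNReal.ofReal (n * δ ^ 2) * ∫⁻ y in gridCube δ k, gradSq φ y)
        + 2 * (volume (gridCube δ k) * ‖m‖ₑ ^ 2) := by gcongr
    _ = _ := by
        rw [enorm_inner_gridFunctional_sq, ← mul_assoc,
          ENNReal.ofReal_mul (zero_le_two (α := ℝ)),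
          ENNReal.ofReal_mul (show (0 : ℝ) ≤ 2 ^ n by positivity),
          ENNReal.ofReal_pow (zero_le_two (α := ℝ)), ENNReal.ofReal_ofNat]

/-- Since `∂ⱼu` is the magnetic derivative minus `i aⱼ u`, a bound on `a` is all that is needed.
Local boundedness of `a` enters the theorem through this comparison; elsewhere `a ∈ L²_loc`
suffices. -/
theorem gradSq_le_energyDensity (V : Space n → ℝ) {u : Space n → ℂ} {x : Space n} {κ : ℝ}
    (hκ : ∀ j, |a x j| ≤ κ) :
    gradSq u x ≤ 2 * energyDensity a V u x + ENNReal.ofReal (2 * n * κ ^ 2) * ‖u x‖ₑ ^ 2 := by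
  have h1 : ∀ j, ‖partialDeriv u j x‖ₑ ^ 2
      ≤ 2 * ‖magneticPartial a u j x‖ₑ ^ 2 + ENNReal.ofReal (2 * κ ^ 2) * ‖u x‖ₑ ^ 2 := by
    intro j
    have h2 := enorm_sq_le_two_mul (partialDeriv u j x) (-(Complex.I * (a x j : ℂ) * u x))
    rw [sub_neg_eq_add, enorm_neg] at h2
    refine h2.trans ?_
    gcongr ?_ + ?_
    · exact le_rfl
    · rw [enorm_mul, enorm_mul, mul_pow, mul_pow, ← mul_assoc, ENNReal.ofReal_mul zero_le_two,
        ENNReal.ofReal_ofNat]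
      gcongr
      rw [enorm_sq_eq_ofReal (a x j : ℂ), Complex.norm_real]
      rw [← ofReal_norm Complex.I, Complex.norm_I, ENNReal.ofReal_one, one_pow, one_mul]
      gcongr
      exact hκ j
  calc gradSq u x ≤ ∑ j, (2 * ‖magneticPartial a u j x‖ₑ ^ 2
        + ENNReal.ofReal (2 * κ ^ 2) * ‖u x‖ₑ ^ 2) := Finset.sum_le_sum fun j _ => h1 j
    _ = 2 * (∑ j, ‖magneticPartial a u j x‖ₑ ^ 2)
        + ENNReal.ofReal (2 * n * κ ^ 2) * ‖u x‖ₑ ^ 2 := by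
        rw [Finset.sum_add_distrib, ← Finset.mul_sum, Finset.sum_const, Finset.card_univ,
          Fintype.card_fin, nsmul_eq_mul, ← mul_assoc, ← ENNReal.ofReal_natCast n,
          ← ENNReal.ofReal_mul (by positivity)]
        congr 3
        ring
    _ ≤ _ := by
        gcongr
        exact le_self_add

theorem exists_ae_abs_le_of_vecLocMemLp_top (ha : VecLocMemLp ⊤ a) (R : ℝ) :
    ∃ κ : ℝ, ∀ᵐ x ∂(volume.restrict (Metric.closedBall (0 : Space n) R)), ∀ j, |a x j| ≤ κ := by
  have h1 : ∀ j, ∃ κ : ℝ, ∀ᵐ x ∂(volume.restrict (Metric.closedBall (0 : Space n) R)),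
      |a x j| ≤ κ := fun j => by
    have hm := ha j _ (isCompact_closedBall (0 : Space n) R)
    refine ⟨(eLpNorm (fun x => a x j) ⊤
      (volume.restrict (Metric.closedBall (0 : Space n) R))).toReal, ?_⟩
    rw [eLpNorm_exponent_top]
    have hfin := hm.2
    rw [eLpNorm_exponent_top] at hfin
    filter_upwards [ae_le_eLpNormEssSup (f := fun x => a x j)
      (μ := volume.restrict (Metric.closedBall (0 : Space n) R))] with x hx
    have := ENNReal.toReal_mono hfin.ne hx
    simpa using this
  choose κ hκ using h1
  refine ⟨∑ j, |κ j|, ?_⟩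
  filter_upwards [ae_all_iff.2 hκ] with x hx j
  exact (hx j).trans ((le_abs_self _).trans
    (Finset.single_le_sum (f := fun j => |κ j|) (fun i _ => abs_nonneg _) (Finset.mem_univ j)))

/-- On bounded sets, functions of bounded energy are controlled by finitely many functionals. -/
theorem exists_lintegral_near_le (V : Space n → ℝ) (ha : VecLocMemLp ⊤ a) (R : ℝ)
    {ε : ℝ} (hε : 0 < ε) :
    ∃ (δ : ℝ) (hδ : 0 < δ) (s : Finset (Fin n → ℤ)), ∀ φ : testFunctions n,
      ∫⁻ y in Metric.closedBall 0 R, ‖(φ : Space n → ℂ) y‖ₑ ^ 2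
        ≤ ENNReal.ofReal ε * ((∫⁻ y, ‖(φ : Space n → ℂ) y‖ₑ ^ 2) + ∫⁻ y, energyDensity a V φ y)
          + ∑ k ∈ s, ‖(inner ℂ (gridFunctional hδ k) (toL2 n φ) : ℂ)‖ₑ ^ 2 := by
  -- The selected grid cubes stay within `|R| + 2 * δ` in each coordinate. As `κ` depends on this
  -- radius and `δ` on `κ`, the radius must not depend on `δ`; hence the restriction `δ < 1`.
  set R' := √n * (|R| + 2) with hR'
  obtain ⟨κ, hκ⟩ := exists_ae_abs_le_of_vecLocMemLp_top ha R'
  -- Twice the Poincaré constant without its `δ²`, times the constant comparing the gradient with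
  -- the form norm.
  set B : ℝ := 2 * (2 ^ n * n) * (2 + 2 * n * κ ^ 2) with hB
  obtain ⟨δ, hδ, hδ1, hδB⟩ : ∃ δ, 0 < δ ∧ δ < 1 ∧ B * δ ^ 2 ≤ ε := by
    have ht : Tendsto (fun d : ℝ => B * d ^ 2) (𝓝[>] 0) (𝓝 0) := by
      have : Tendsto (fun d : ℝ => B * d ^ 2) (𝓝 0) (𝓝 (B * 0 ^ 2)) :=
        (by fun_prop : Continuous fun d : ℝ => B * d ^ 2).tendsto 0
      simpa using this.mono_left nhdsWithin_le_nhds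
    obtain ⟨d, h1, h2, h3⟩ := ((ht.eventually (gt_mem_nhds hε)).and
      ((eventually_mem_nhdsWithin).and
        (nhdsWithin_le_nhds (gt_mem_nhds one_pos)))).exists
    exact ⟨d, h2, h3, h1.le⟩
  set M : ℤ := ⌈|R| / δ⌉ with hM
  have hM1 : |R| / δ ≤ M := Int.le_ceil _
  have hM2 : (M : ℝ) < |R| / δ + 1 := Int.ceil_lt_add_one _
  set s : Finset (Fin n → ℤ) := Fintype.piFinset fun _ => Finset.Icc (-M - 1) M with hs
  have hcover : Metric.closedBall (0 : Space n) R ⊆ ⋃ k ∈ s, gridCube δ k := by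
    intro y hy
    refine mem_iUnion₂.2 ⟨fun j => ⌊y j / δ⌋, ?_, fun j => rfl⟩
    rw [hs, Fintype.mem_piFinset]
    intro j
    have h1 : |y j| ≤ |R| :=
      (PiLp.norm_apply_le y j).trans ((mem_closedBall_zero_iff.1 hy).trans (le_abs_self R))
    have h2 : |y j / δ| ≤ M := by
      rw [abs_div, abs_of_pos hδ]
      exact le_trans (by gcongr) hM1
    have h3 := abs_le.1 h2
    rw [Finset.mem_Icc]
    constructor
    · rw [Int.le_floor]
      push_cast
      linarith [h3.1]
    · have : (⌊y j / δ⌋ : ℝ) ≤ M := (Int.floor_le _).trans h3.2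
      exact_mod_cast this
  have hbdd : ∀ k ∈ s, gridCube δ k ⊆ Metric.closedBall (0 : Space n) R' := by
    intro k hk y hy
    rw [mem_closedBall_zero_iff]
    refine norm_le_sqrt_mul (by positivity) fun j => ?_
    have h1 := (mem_gridCube_iff hδ).1 hy j
    have h2 := Finset.mem_Icc.1 (Fintype.mem_piFinset.1 hk j)
    have h3 : (-M - 1 : ℝ) ≤ k j := by exact_mod_cast h2.1
    have h4 : (k j : ℝ) ≤ M := by exact_mod_cast h2.2
    have h5 : δ * M ≤ |R| + δ := by
      calc δ * M ≤ δ * (|R| / δ + 1) := by gcongr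
        _ = |R| + δ := by field_simp
    have h6 := mul_le_mul_of_nonneg_left h3 hδ.le
    have h7 := mul_le_mul_of_nonneg_left h4 hδ.le
    rw [abs_le]
    constructor <;> linarith [h1.1, h1.2]
  refine ⟨δ, hδ, s, fun φ => ?_⟩
  set I := ∫⁻ y, ‖(φ : Space n → ℂ) y‖ₑ ^ 2 with hI
  set G := ∫⁻ y, energyDensity a V φ y with hG
  have hdisj : (s : Set (Fin n → ℤ)).PairwiseDisjoint (gridCube (n := n) δ) := fun k _ l _ hkl =>
    pairwise_disjoint_gridCube δ hkl
  have hsum : ∀ f : Space n → ℝ≥0∞, ∑ k ∈ s, ∫⁻ y in gridCube δ k, f y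
      = ∫⁻ y in ⋃ k ∈ s, gridCube δ k, f y := fun f =>
    (lintegral_biUnion_finset hdisj (fun k _ => measurableSet_gridCube δ k) f).symm
  have hφm : Measurable fun y => ‖(φ : Space n → ℂ) y‖ₑ ^ 2 :=
    (φ.2.1.continuous.enorm.measurable).pow_const 2
  have hgrad : ∫⁻ y in ⋃ k ∈ s, gridCube δ k, gradSq φ y
      ≤ ENNReal.ofReal (2 + 2 * n * κ ^ 2) * (I + G) := by
    calc _ ≤ ∫⁻ y in Metric.closedBall (0 : Space n) R', gradSq φ y :=
          lintegral_mono_set (iUnion₂_subset hbdd)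
      _ ≤ ∫⁻ y in Metric.closedBall (0 : Space n) R', (2 * energyDensity a V φ y
          + ENNReal.ofReal (2 * n * κ ^ 2) * ‖(φ : Space n → ℂ) y‖ₑ ^ 2) := by
          refine lintegral_mono_ae ?_
          filter_upwards [hκ] with y hy
          exact gradSq_le_energyDensity V hy
      _ ≤ ∫⁻ y, (2 * energyDensity a V φ y
          + ENNReal.ofReal (2 * n * κ ^ 2) * ‖(φ : Space n → ℂ) y‖ₑ ^ 2) :=
          setLIntegral_le_lintegral _ _
      _ = ENNReal.ofReal 2 * G + ENNReal.ofReal (2 * n * κ ^ 2) * I := by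
          rw [lintegral_add_right _ (hφm.const_mul _), lintegral_const_mul' _ _ (by simp),
            lintegral_const_mul' _ _ ENNReal.ofReal_ne_top, ENNReal.ofReal_ofNat]
      _ ≤ ENNReal.ofReal (2 + 2 * n * κ ^ 2) * G + ENNReal.ofReal (2 + 2 * n * κ ^ 2) * I := by
          gcongr
          · linarith [show 0 ≤ 2 * (n : ℝ) * κ ^ 2 by positivity]
          · linarith
      _ = _ := by ring
  calc _ ≤ ∫⁻ y in ⋃ k ∈ s, gridCube δ k, ‖(φ : Space n → ℂ) y‖ₑ ^ 2 := lintegral_mono_set hcover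
    _ = ∑ k ∈ s, ∫⁻ y in gridCube δ k, ‖(φ : Space n → ℂ) y‖ₑ ^ 2 := (hsum _).symm
    _ ≤ ∑ k ∈ s, (ENNReal.ofReal (2 * (2 ^ n * (n * δ ^ 2))) * (∫⁻ y in gridCube δ k, gradSq φ y)
        + ‖(inner ℂ (gridFunctional hδ k) (toL2 n φ) : ℂ)‖ₑ ^ 2) :=
        Finset.sum_le_sum fun k _ => lintegral_gridCube_le hδ k φ
    _ = ENNReal.ofReal (2 * (2 ^ n * (n * δ ^ 2))) * (∫⁻ y in ⋃ k ∈ s, gridCube δ k, gradSq φ y)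
        + ∑ k ∈ s, ‖(inner ℂ (gridFunctional hδ k) (toL2 n φ) : ℂ)‖ₑ ^ 2 := by
        rw [Finset.sum_add_distrib, ← Finset.mul_sum, hsum]
    _ ≤ _ := by
        gcongr ?_ + _
        calc _ ≤ ENNReal.ofReal (2 * (2 ^ n * (n * δ ^ 2)))
              * (ENNReal.ofReal (2 + 2 * n * κ ^ 2) * (I + G)) := by gcongr
          _ = ENNReal.ofReal (B * δ ^ 2) * (I + G) := by
              rw [← mul_assoc, ← ENNReal.ofReal_mul (by positivity)]
              congr 2
              rw [hB]
              ring
          _ ≤ _ := by gcongr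

theorem le_of_near_le_of_far_le {ε I G S : ℝ} (hε : 0 ≤ ε) (hI : 0 ≤ I) (hG : 0 ≤ G) (hS : 0 ≤ S)
    {near far : ℝ≥0∞} (h : ENNReal.ofReal I = near + far)
    (h2 : near ≤ ENNReal.ofReal (ε / 2) * (ENNReal.ofReal I + ENNReal.ofReal G)
      + ENNReal.ofReal S)
    (h1 : far ≤ ENNReal.ofReal (ε / 2) * ENNReal.ofReal G) : I ≤ ε * (I + G) + S := by
  rw [← ENNReal.ofReal_add hI hG, ← ENNReal.ofReal_mul (by positivity),
    ← ENNReal.ofReal_add (by positivity) hS] at h2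
  rw [← ENNReal.ofReal_mul (by positivity)] at h1
  have h3 := h.le.trans (add_le_add h2 h1)
  rw [← ENNReal.ofReal_add (by positivity) (by positivity),
    ENNReal.ofReal_le_ofReal_iff (by positivity)] at h3
  nlinarith [mul_nonneg hε hI]

end Global

end MagneticSchrodinger

/-! ### Conclusion: combining the far and near estimates. -/

open MagneticSchrodinger in
theorem corollaryC (n : ℕ) (hn : 2 ≤ n)
    (a : EuclideanSpace ℝ (Fin n) → EuclideanSpace ℝ (Fin n))
    (V : EuclideanSpace ℝ (Fin n) → ℝ)
    (ha : MagneticSchrodinger.VecLocMemLp ⊤ a)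
    (hV : LocallyIntegrable V volume) (hV0 : ∀ᵐ x, 0 ≤ V x)
    (c d₁ : ℝ) (hc : 0 < c) (hd₁ : 0 < d₁)
    (h : ∀ d : ℝ, 0 < d → d < d₁ →
      Tendsto (fun x : EuclideanSpace ℝ (Fin n) =>
          MagneticSchrodinger.localEnergy a x d
            + (ENNReal.ofReal (d ^ n))⁻¹ * MagneticSchrodinger.molchanov c x d V)
        (cocompact (EuclideanSpace ℝ (Fin n))) (𝓝 ⊤)) :
    MagneticSchrodinger.HasDiscreteSpectrum
      (MagneticSchrodinger.magneticSchrodinger a V (ha.of_top 2) hV hV0) := by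
  refine hasDiscreteSpectrum_of_finite_control (ha.of_top 2) hV hV0 fun ε hε => ?_
  -- The radius comes from the tail estimate and only then is the grid chosen on that ball; both are
  -- uniform in `φ`.
  obtain ⟨R, hfar⟩ := exists_lintegral_far_le hn (ha.of_top 2) hV hc hd₁ h (half_pos hε)
  obtain ⟨δ, hδ, s, hnear⟩ := exists_lintegral_near_le V ha R (half_pos hε)
  refine ⟨s, inferInstance, fun k => gridFunctional hδ k, fun φ => ?_⟩
  have hGe := ofReal_sum_norm_componentL2_sq (ha.of_top 2) hV hV0 φ
  have hIe := ofReal_norm_toL2_sq φ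
  have h1 := hfar φ
  have h2 := hnear φ
  have hsum : ∑ k ∈ s, ‖(inner ℂ (gridFunctional hδ k) (toL2 n φ) : ℂ)‖ₑ ^ 2
      = ENNReal.ofReal
        (∑ k : s, ‖(inner ℂ (gridFunctional hδ (k : Fin n → ℤ)) (toL2 n φ) : ℂ)‖ ^ 2) := by
    rw [ENNReal.ofReal_sum_of_nonneg fun _ _ => sq_nonneg _, ← Finset.sum_coe_sort]
    simp only [enorm_sq_eq_ofReal]
  rw [← hGe] at h1
  rw [← hGe, ← hIe, hsum] at h2
  refine le_of_near_le_of_far_le hε.le (sq_nonneg _) (Finset.sum_nonneg fun _ _ => sq_nonneg _)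
    (Finset.sum_nonneg fun _ _ => sq_nonneg _) ?_ h2 h1
  rw [hIe, lintegral_add_compl _ Metric.isClosed_closedBall.measurableSet]

end
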